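/- **Problem.** Let $T\ge 0$. For $t=0,\dots,T$ let $\Omega_t$ be a finite sample set ($\Omega_0$ has one point) with probabilities $\mathbb P_t(\omega_t)$; the outcomes of different stages are independent, so $\omega=(\omega_0,\dots,\omega_T)\in\Omega=\Omega_0\times\dots\times\Omega_T$ has probability $\mathbb P(\omega)=\prod_t\mathbb P_t(\omega_t)$. For each outcome $\omega_t\in\Omega_t$ let matrices $A_t,B_t$ and vectors $b_t,c_t$ be given. Put $R_{-1}=0$. A decision $x_t$ of stage $t$ produces the resource state $R_t=B_tx_t$, and the feasible set of stage $t$ is $$\mathcal X_t(R_{t-1},\omega_t)=\{x_t\ge 0:\ R_{t-1}+A_tx_t=b_t\}.$$ A policy $X=(X_t)_t$ maps a state $(R_{t-1},\omega_t)$ to a decision. The problem is to minimize $\mathbb E\sum_{t=0}^T\langle c_t,X_t(R_{t-1},\omega_t)\rangle$ over all policies that are feasible in all scenarios. Let $V_t^*(R_t)$ be the infimum, over policies that are feasible from $R_t$ on, of the expected cost of the stages $t+1,\dots,T$; so $V_T^*\equiv0$. **Algorithm.** Let $Q_t$ be positive semidefinite ($t=0,\dots,T$) and let $\varrho^k$ be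 real numbers, $k\in\mathbb N$. Set $\overline V_T^k:=V_T^*$ for all $k$. Iteration $k=0,1,2,\dots$ consists of the following two passes. *Forward pass.* Sample $\omega^k\in\Omega$ and put $R^k_{-1}=0$. For $t=0,\dots,T$ select a minimizer $x_t^k$ over $x\in\mathcal X_t(R_{t-1}^k,\omega_t^k)$ of * $\langle c_t,x\rangle$ if $k=0$; * $\langle c_t,x\rangle+\overline V_t^{k-1}(B_tx)+\frac{\varrho^k}{2}\langle B_tx-R_t^{k-1},Q_t(B_tx-R_t^{k-1})\rangle$ if $k\ge1$ and $t<T$; * $\langle c_T,x\rangle+\overline V_T^{k-1}(B_Tx)$ if $k\ge 1$ and $t=T$; and put $R_t^k=B_tx_t^k$. *Backward pass.* For $t=T,\dots,1$ let $\underline V_t^k(R,\omega_t)=\min_{x\in\mathcal X_t(R,\omega_t)}\{\langle c_t,x\rangle+\overline V_t^k(B_tx)\}$, select subgradients $\beta_t^k(\omega_t)\in\partial_R\underline V_t^k(R_{t-1}^k,\omega_t)$ for all $\omega_t\in\Omega_t$, form the cut $$h_{t-1}^k(R)=\sum_{\omega_t}\mathbb P_t(\omega_t)\underline V_t^k(R_{t-1}^k,\omega_t)+\Big\langle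 \sum_{\omega_t}\mathbb P_t(\omega_t)\beta_t^k(\omega_t),\,R-R_{t-1}^k\Big\rangle ,$$ and set $\overline V_{t-1}^k=\max_{j\le k}h_{t-1}^j$. **Sampling.** The algorithm is run on a probability space. The paths $\omega^0,\omega^1,\dots$ are drawn independently from $\mathbb P$, and selections do not anticipate samples: for all $k$ and $t$, $\omega_t^k$ has law $\mathbb P_t$ and is independent of all samples, selections and cuts of the iterations $j<k$ together with the samples and decisions of the stages $s<t$ of forward pass $k$. Selections among several minimizers or subgradients are otherwise arbitrary (measurable). **Theorem.** Assume relatively complete recourse: the feasible set of stage $0$ is non-empty, and after any feasible decisions of stages $0,\dots,t-1$ the feasible set of stage $t$ is non-empty for every $\omega_t\in\Omega_t$. Assume further: 1. $\overline V_T^k\equiv V_T^*$ for all $k$; 2. dual basic optimal solutions are used in the backward pass, i.e. $-\beta^k_t(\omega_t)$ is the vector of multipliers of the constraints $A_tx=b_t-R_{t-1}^k$ in some basic optimal solution of the dual of the linear program defining $\underline V_t^k(R_{t-1}^k,\omega_t)$, with the cuts written as linear inequalities. (If $A_t$ has linearly dependent rows, logical columns may belong to the basis: a dual feasible point is basic if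 it is uniquely determined by the dual constraints active at it together with those of its coordinates that vanish); 3. $\mathbb P(\omega)>0$ for every $\omega\in\Omega$; 4. $\varrho^k\ge0$ for all $k$, and $\lim_{k\to\infty}\varrho^k=0$; 5. for each $t=0,\dots,T$ the sets $\mathcal X_t(R_{t-1},\omega_t)$ are bounded for every $\omega_t\in\Omega_t$ and every $R_{t-1}$ that results from feasible decisions. Then with probability one there are a (random) finite $K$ and an optimal policy $X$ of the problem such that for all $k\ge K$: $\overline V_t^k=\overline V_t^K$ for $t=0,\dots,T$, and for every $\omega\in\Omega$ and $t=0,\dots,T$, in the state $(R_{t-1},\omega_t)$ visited by $X$ along $\omega$, the decision of $X$ minimizes over $\mathcal X_t(R_{t-1},\omega_t)$ both $\langle c_t,x\rangle+\overline V_t^k(B_tx)$ and $\langle c_t,x\rangle+V_t^*(B_tx)$, and $$\min_{x\in\mathcal X_t(R_{t-1},\omega_t)}\{\langle c_t,x\rangle+\overline V_t^k(B_tx)\}=\min_{x\in\mathcal X_t(R_{t-1},\omega_t)}\{\langle c_t,x\rangle+V_t^*(B_tx)\}.$$ -/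

import Mathlib

open MeasureTheory ProbabilityTheory
open scoped Matrix

noncomputable section

/-- Data of a stagewise independent multistage stochastic linear program with stages `0, …, T` and
finite sample sets `Ω t = Fin (N t)`.  Only the data of the stages `t ≤ T` are ever used; all
families are indexed by `ℕ` for convenience.  Stage `t` has `n t` variables and `m t` equality
constraints, and `B t w` maps a decision of stage `t` to the resource state seen by stage `t + 1`.
Stage `0` is deterministic, that is, its sample set has one point.  `p t w` is the probability of
the outcome `w` of stage `t`; outcomes of different stages are independent. -/
structure MSLP where
  T : ℕ
  n : ℕ → ℕ
  m : ℕ → ℕ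
  N : ℕ → ℕ
  N_pos : ∀ t, 0 < N t
  N_zero : N 0 = 1
  A : ∀ t, Fin (N t) → Matrix (Fin (m t)) (Fin (n t)) ℝ
  B : ∀ t, Fin (N t) → Matrix (Fin (m (t + 1))) (Fin (n t)) ℝ
  b : ∀ t, Fin (N t) → Fin (m t) → ℝ
  c : ∀ t, Fin (N t) → Fin (n t) → ℝ
  p : ∀ t, Fin (N t) → ℝ
  p_nonneg : ∀ t, t ≤ T → ∀ w, 0 ≤ p t w
  p_sum : ∀ t, t ≤ T → ∑ w, p t w = 1

namespace MSLP

variable (P : MSLP)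

/-- The sample set of stage `t`. -/
abbrev Om (t : ℕ) : Type := Fin (P.N t)

/-- Resource states with which stage `t` is entered, that is, post-decision resource states
`R^x_{t-1} = B_{t-1} x_{t-1}` of stage `t - 1`.  Stage `0` is entered with the state `0`. -/
abbrev State (t : ℕ) : Type := Fin (P.m t) → ℝ

/-- Decision vectors of stage `t`. -/
abbrev Dec (t : ℕ) : Type := Fin (P.n t) → ℝ

/-- A realization of the information process, of which the coordinates `t ≤ T` matter. -/
abbrev Realization : Type := ∀ t : ℕ, P.Om t

/-- The finite scenario set `Ω = Ω_0 × Ω_1 × ⋯ × Ω_T` (`Ω_0` has one point). -/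
abbrev Scenario : Type := ∀ t : Fin (P.T + 1), P.Om t

/-- The probability of a scenario under stagewise independence. -/
def scenarioProb (ω : P.Scenario) : ℝ := ∏ t : Fin (P.T + 1), P.p t (ω t)

/-- A scenario, continued arbitrarily beyond the horizon. -/
def extend (ω : P.Scenario) : P.Realization := fun t =>
  if h : t < P.T + 1 then ω ⟨t, h⟩ else ⟨0, P.N_pos t⟩

/-- The feasible set of stage `t` entered with the resource state `R`, at outcome `w`:
`x ≥ 0` and `R + A_t x = b_t`. -/
def feas (t : ℕ) (R : P.State t) (w : P.Om t) : Set (P.Dec t) :=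
  {x | 0 ≤ x ∧ R + P.A t w *ᵥ x = P.b t w}

/-- The stage objective `⟨c_t, x⟩ + V(B_t x)` for a post-decision value function `V`. -/
def stageObj (t : ℕ) (V : P.State (t + 1) → ℝ) (w : P.Om t) (x : P.Dec t) : ℝ :=
  P.c t w ⬝ᵥ x + V (P.B t w *ᵥ x)

/-- The stage optimal value `min {⟨c_t, x⟩ + V(B_t x) : x feasible}`. -/
def stageVal (t : ℕ) (V : P.State (t + 1) → ℝ) (R : P.State t) (w : P.Om t) : ℝ :=
  sInf (P.stageObj t V w '' P.feas t R w)

/-- `x` is a feasible minimizer of `f` at stage `t`. -/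
def IsArgmin (t : ℕ) (R : P.State t) (w : P.Om t) (f : P.Dec t → ℝ) (x : P.Dec t) : Prop :=
  x ∈ P.feas t R w ∧ ∀ y ∈ P.feas t R w, f x ≤ f y

/-- The resource states with which stage `t` can be entered after feasible decisions. -/
def reach : ∀ t, Set (P.State t)
  | 0 => {0}
  | t + 1 => {R' | ∃ R ∈ reach t, ∃ w, ∃ x ∈ P.feas t R w, R' = P.B t w *ᵥ x}

/-- Relatively complete recourse (for `t = 0`: the first stage problem is feasible). -/
def RelativelyCompleteRecourse : Prop :=
  ∀ t, t ≤ P.T → ∀ R ∈ P.reach t, ∀ w, (P.feas t R w).Nonempty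

/-- The feasible sets of all stages are bounded. -/
def BoundedFeasibleSets : Prop :=
  ∀ t, t ≤ P.T → ∀ R ∈ P.reach t, ∀ w, Bornology.IsBounded (P.feas t R w)

/-! ### Policies and the optimal value functions -/

/-- A policy maps the state (resource state and current outcome) to a decision. -/
abbrev Policy : Type := ∀ t, P.State t → P.Om t → P.Dec t

/-- Total cost of `d` consecutive stages from stage `t` on, entered with the state `R`, when the
policy `X` is followed along `ω`. -/
def pathCost (X : P.Policy) (ω : P.Realization) : (d t : ℕ) → P.State t → ℝ
  | 0, _, _ => 0
  | d + 1, t, R => P.c t (ω t) ⬝ᵥ X t R (ω t) +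
      pathCost X ω d (t + 1) (P.B t (ω t) *ᵥ X t R (ω t))

/-- Feasibility of the decisions of `X` along `ω` in `d` consecutive stages from stage `t` on,
entered with the state `R`. -/
def PathFeasible (X : P.Policy) (ω : P.Realization) : (d t : ℕ) → P.State t → Prop
  | 0, _, _ => True
  | d + 1, t, R => X t R (ω t) ∈ P.feas t R (ω t) ∧
      PathFeasible X ω d (t + 1) (P.B t (ω t) *ᵥ X t R (ω t))

/-- The policy is feasible in the stages `t, …, T` when stage `t` is entered with the state `R`. -/
def FeasibleFrom (X : P.Policy) (t : ℕ) (R : P.State t) : Prop :=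
  ∀ ω : P.Realization, P.PathFeasible X ω (P.T + 1 - t) t R

/-- Expected cost of the stages `t, …, T` when stage `t` is entered with the state `R`. -/
def expCost (X : P.Policy) (t : ℕ) (R : P.State t) : ℝ :=
  ∑ ω : P.Scenario, P.scenarioProb ω * P.pathCost X (P.extend ω) (P.T + 1 - t) t R

/-- The optimal post-decision value function `V*_t`: the optimal expected cost of the stages
`t + 1, …, T` over all feasible policies, as a function of the post-decision state of stage `t`.
In particular `V*_T = 0`. -/
def Vstar (t : ℕ) (R : P.State (t + 1)) : ℝ :=
  sInf {v | ∃ X : P.Policy, P.FeasibleFrom X (t + 1) R ∧ v = P.expCost X (t + 1) R}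

/-- `X` is an optimal policy of the multistage problem. -/
def IsOptimalPolicy (X : P.Policy) : Prop :=
  P.FeasibleFrom X 0 0 ∧ ∀ Y : P.Policy, P.FeasibleFrom Y 0 0 → P.expCost X 0 0 ≤ P.expCost Y 0 0

/-- The resource state with which stage `t` is entered when `X` is followed along `ω`. -/
def stateAt (X : P.Policy) (ω : P.Realization) : ∀ t, P.State t
  | 0 => 0
  | t + 1 => P.B t (ω t) *ᵥ X t (stateAt X ω t) (ω t)

/-- The value function approximations `V t` give the optimal policy `X`: `X` is optimal, and in
every state that it visits, its decision minimizes both the approximate objective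
`⟨c_t, x⟩ + V_t(B_t x)` and the true objective `⟨c_t, x⟩ + V*_t(B_t x)`, with equal minima. -/
def GivesOptimalPolicy (V : ∀ t, P.State (t + 1) → ℝ) (X : P.Policy) : Prop :=
  P.IsOptimalPolicy X ∧
  ∀ ω : P.Realization, ∀ t, t ≤ P.T →
    P.IsArgmin t (P.stateAt X ω t) (ω t) (P.stageObj t (V t) (ω t))
      (X t (P.stateAt X ω t) (ω t)) ∧
    P.IsArgmin t (P.stateAt X ω t) (ω t) (P.stageObj t (P.Vstar t) (ω t))
      (X t (P.stateAt X ω t) (ω t)) ∧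
    P.stageVal t (V t) (P.stateAt X ω t) (ω t) =
      P.stageVal t (P.Vstar t) (P.stateAt X ω t) (ω t)

/-! ### The regularized algorithm -/

/-- The variables of a run of the algorithm.  `ω k` is the sampled path and `x k` the sequence of
forward decisions of iteration `k`.  For `t < T`, `β k t w` is the subgradient selected in the
backward pass of iteration `k` for the stage `t + 1` problem at outcome `w`, and `α k t` is the
value of the new cut of stage `t` at the visited resource state. -/
structure Trace where
  ω : ℕ → P.Realization
  x : ℕ → ∀ t, P.Dec t
  α : ℕ → ℕ → ℝ
  β : ℕ → ∀ t, P.Om (t + 1) → P.State (t + 1)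

namespace Trace

variable {P}
variable (τ : P.Trace)

/-- The post-decision resource state `R^{x,k}_t` visited in the forward pass. -/
def resource (k t : ℕ) : P.State (t + 1) := P.B t (τ.ω k t) *ᵥ τ.x k t

/-- The resource state with which stage `t` is entered in forward pass `k`. -/
def entering (k : ℕ) : ∀ t, P.State t
  | 0 => 0
  | t + 1 => τ.resource k t

/-- The slope `β^k_t` of the aggregated cut. -/
def slope (k t : ℕ) : P.State (t + 1) := ∑ w, P.p (t + 1) w • τ.β k t w

/-- The aggregated cut `h^k_t`. -/
def cut (k t : ℕ) (R : P.State (t + 1)) : ℝ :=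
  τ.α k t + τ.slope k t ⬝ᵥ (R - τ.resource k t)

/-- The approximation held at the end of iteration `k`: the maximum of the cuts of the iterations
`0, …, k` for `t < T`, and the exact function `V*_T` for `t = T`. -/
def Vbar (k t : ℕ) (R : P.State (t + 1)) : ℝ :=
  if t < P.T then
    (Finset.range (k + 1)).sup' Finset.nonempty_range_add_one (fun j => τ.cut j t R)
  else P.Vstar t R

/-- The objective of the forward pass of iteration `k` at stage `t`: the cost alone in
iteration `0`; afterwards cost plus approximation, with a quadratic regularization around the
resource state visited in the previous forward pass if `t < T`. -/
def forwardObj (Q : ∀ t, Matrix (Fin (P.m (t + 1))) (Fin (P.m (t + 1))) ℝ) (ρ : ℕ → ℝ) :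
    (k t : ℕ) → P.Dec t → ℝ
  | 0, t, y => P.c t (τ.ω 0 t) ⬝ᵥ y
  | k + 1, t, y =>
      P.stageObj t (τ.Vbar k t) (τ.ω (k + 1) t) y +
        if t < P.T then
          ρ (k + 1) / 2 *
            ((P.B t (τ.ω (k + 1) t) *ᵥ y - τ.resource k t) ⬝ᵥ
              (Q t *ᵥ (P.B t (τ.ω (k + 1) t) *ᵥ y - τ.resource k t)))
        else 0

/-- `τ` is a run of the algorithm.  In the third clause, `β` is a subgradient of the optimal value
of the stage `t + 1` problem as a function of the resource state (`+∞` where infeasible). -/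
structure IsRun (Q : ∀ t, Matrix (Fin (P.m (t + 1))) (Fin (P.m (t + 1))) ℝ) (ρ : ℕ → ℝ) :
    Prop where
  forward : ∀ k t, t ≤ P.T →
    P.IsArgmin t (τ.entering k t) (τ.ω k t) (τ.forwardObj Q ρ k t) (τ.x k t)
  intercept : ∀ k t, t < P.T → τ.α k t =
    ∑ w, P.p (t + 1) w * P.stageVal (t + 1) (τ.Vbar k (t + 1)) (τ.resource k t) w
  subgradient : ∀ k t, t < P.T → ∀ w, ∀ R, (P.feas (t + 1) R w).Nonempty →
    P.stageVal (t + 1) (τ.Vbar k (t + 1)) (τ.resource k t) w +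
        τ.β k t w ⬝ᵥ (R - τ.resource k t) ≤
      P.stageVal (t + 1) (τ.Vbar k (t + 1)) R w

end Trace

/-! ### Dual basic optimal solutions

The stage problem with the approximation `V = max_j (a_j + ⟨g_j, ·⟩)` is the linear program
`min ⟨c_t, x⟩ + θ` subject to `A_t x = b_t - R`, `θ - ⟨g_j, B_t x⟩ ≥ a_j` for all `j`, `x ≥ 0`. -/

/-- Dual feasibility of multipliers `u` (equality rows) and `l` (cut rows). -/
def DualFeasible (t : ℕ) (w : P.Om t) {ι : Type} [Fintype ι] (g : ι → P.State (t + 1))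
    (u : P.State t) (l : ι → ℝ) : Prop :=
  (∀ j, 0 ≤ l j) ∧ ∑ j, l j = 1 ∧
    ∀ i, (u ᵥ* P.A t w) i - ∑ j, l j * (g j ᵥ* P.B t w) i ≤ P.c t w i

/-- The dual objective. -/
def dualObj (t : ℕ) (w : P.Om t) {ι : Type} [Fintype ι] (a : ι → ℝ) (R : P.State t)
    (u : P.State t) (l : ι → ℝ) : ℝ :=
  u ⬝ᵥ (P.b t w - R) + ∑ j, l j * a j

/-- `(u, l)` is a basic solution of the dual: it is determined uniquely by the dual constraints
that hold with equality at it.  As in the simplex method, every row carries a logical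
column, so that a vanishing multiplier counts as an equality for every row (for a cut row this is
the constraint `l j ≥ 0`; for an equality row it means that the logical variable of the row is in
the basis, which has to be allowed because the rows of `A_t` may be linearly dependent). -/
def DualBasic (t : ℕ) (w : P.Om t) {ι : Type} [Fintype ι] (g : ι → P.State (t + 1))
    (u : P.State t) (l : ι → ℝ) : Prop :=
  ∀ (u' : P.State t) (l' : ι → ℝ),
    (∀ r, u r = 0 → u' r = 0) → (∀ j, l j = 0 → l' j = 0) → ∑ j, l' j = 0 →
    (∀ i, (u ᵥ* P.A t w) i - ∑ j, l j * (g j ᵥ* P.B t w) i = P.c t w i →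
      (u' ᵥ* P.A t w) i - ∑ j, l' j * (g j ᵥ* P.B t w) i = 0) →
    u' = 0 ∧ l' = 0

/-- `(u, l)` is a dual basic optimal solution. -/
def DualBasicOptimal (t : ℕ) (w : P.Om t) {ι : Type} [Fintype ι] (g : ι → P.State (t + 1))
    (a : ι → ℝ) (R : P.State t) (u : P.State t) (l : ι → ℝ) : Prop :=
  P.DualFeasible t w g u l ∧ P.DualBasic t w g u l ∧
    ∀ u' l', P.DualFeasible t w g u' l' → P.dualObj t w a R u' l' ≤ P.dualObj t w a R u l

/-- The backward pass uses dual basic optimal solutions: each selected subgradient is the negative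
of the vector of multipliers of the equality rows of a dual basic optimal solution of the stage
`t + 1` problem.  For `t + 1 < T` the problem contains the cuts of the iterations `0, …, k`; for
`t + 1 = T` the value function `V*_T = 0` is represented by a single zero cut. -/
def Trace.UsesDualBasic {P : MSLP} (τ : P.Trace) : Prop :=
  ∀ k t, t < P.T → ∀ w : P.Om (t + 1),
    if t + 1 < P.T then
      ∃ u, ∃ l : Fin (k + 1) → ℝ,
        P.DualBasicOptimal (t + 1) w (fun j : Fin (k + 1) => τ.slope j (t + 1))
          (fun j : Fin (k + 1) => τ.α j (t + 1) - τ.slope j (t + 1) ⬝ᵥ τ.resource j (t + 1))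
          (τ.resource k t) u l ∧ τ.β k t w = -u
    else
      ∃ u, ∃ l : Unit → ℝ,
        P.DualBasicOptimal (t + 1) w (fun _ => 0) (fun _ => 0) (τ.resource k t) u l ∧
          τ.β k t w = -u

/-! ### Random sampling -/

/-- The information available before the outcome of stage `t` is sampled in iteration `k`: all
samples, selections and cuts of earlier iterations, and the samples and decisions of the earlier stages
in the forward pass of iteration `k`. -/
abbrev past {S : Type*} (τ : S → P.Trace) (k t : ℕ) : MeasurableSpace S :=
  (⨆ j, ⨆ (_ : j < k), ⨆ s, ⨆ (_ : s ≤ P.T),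
      (MeasurableSpace.comap (fun z => (τ z).ω j s) inferInstance ⊔
        MeasurableSpace.comap (fun z => (τ z).x j s) inferInstance)) ⊔
  (⨆ j, ⨆ (_ : j < k), ⨆ s, ⨆ (_ : s < P.T),
      (MeasurableSpace.comap (fun z => (τ z).α j s) inferInstance ⊔
        ⨆ w, MeasurableSpace.comap (fun z => (τ z).β j s w) inferInstance)) ⊔
  (⨆ s, ⨆ (_ : s < t),
      (MeasurableSpace.comap (fun z => (τ z).ω k s) inferInstance ⊔
        MeasurableSpace.comap (fun z => (τ z).x k s) inferInstance))

/-- The paths are sampled independently from the scenario distribution, and the selections of the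
algorithm do not anticipate the samples: the outcome of stage `t` in iteration `k` has the
distribution `p t` and is independent of everything sampled or selected before. -/
structure SampledIndependently {S : Type*} [MeasurableSpace S] (μ : Measure S)
    (τ : S → P.Trace) : Prop where
  measurable_sample : ∀ k t, t ≤ P.T → Measurable (fun z => (τ z).ω k t)
  measurable_decision : ∀ k t, t ≤ P.T → Measurable (fun z => (τ z).x k t)
  measurable_intercept : ∀ k t, t < P.T → Measurable (fun z => (τ z).α k t)
  measurable_subgradient : ∀ k t, t < P.T → ∀ w, Measurable (fun z => (τ z).β k t w)
  law : ∀ k t, t ≤ P.T → ∀ w, μ {z | (τ z).ω k t = w} = ENNReal.ofReal (P.p t w)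
  indep : ∀ k t, t ≤ P.T →
    Indep (MeasurableSpace.comap (fun z => (τ z).ω k t) inferInstance) (P.past τ k t) μ

end MSLP

end

/-!
The proof is pathwise except for one probabilistic fact. Fix a run of the algorithm.

*Finitely many cuts.* The multipliers of a dual basic solution are determined by the vanishing
coordinates and the active constraints (`finite_basicSolutions`); multipliers of repeated cuts may
be added up, so the number of possibilities does not grow with the iteration. By strong duality
(`stageVal_eq_dualObj`) the constant terms of the cuts of stage `t` are also determined by such
dual solutions and by the cuts of stage `t + 1`. Hence only finitely many cuts are ever generated
and the approximations are eventually equal to fixed functions `V_t`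
(`Trace.IsRun.exists_forall_Vbar_eq`). Strong duality is cheap here: the selected multipliers are
subgradients of the stage value, so that only the multipliers of the cuts have to be found, and
these come from separating an open convex set from a convex set.

*Lower bounds.* The cuts are valid, so `V_t` bounds the expected cost of every feasible policy from
below (`Trace.IsRun.Vbar_le_expCost`).

*Cluster points.* The visited states need not take finitely many values, because of the
regularization and the arbitrary selection of minimizers. Consider instead the cluster points `R`
of the states with which stage `t` is entered (`Trace.limitStates`). Lévy's extension of the
Borel–Cantelli lemma shows that almost surely `R` is also a cluster point along the iterations in
which a prescribed outcome `w` of stage `t` is sampled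
(`SampledIndependently.ae_forall_mapClusterPt`). The forward decisions of these iterations minimize
the objective with `V_t` up to an error that vanishes with `ρ`, and the feasible sets are uniformly
bounded, so the decisions have a cluster point `x`; it minimizes the objective with `V_t` at
`(R, w)`, and `B_t x` is again a cluster point of visited states
(`Trace.IsRun.exists_isArgmin_limitStates`). Since the cut added at a visited state is exact there,
`V_t(R) ≥ ∑ w, p_w min {⟨c_{t+1}, x⟩ + V_{t+1}(B_{t+1} x)}` at cluster points `R`
(`Trace.IsRun.sum_stageVal_le_Vbar`).

*Conclusion.* The policy that selects the decisions `x` at cluster points stays in cluster points;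
by the last inequality its expected cost is at most `V_t`, which is a lower bound for all policies
(`givesOptimalPolicy_of_invariant`). So it is optimal, `V_t = V*_t` in the states that it visits,
and its decisions also minimize the objectives with `V*_t`.
-/

namespace MSLP

open Filter Topology

variable {P : MSLP}

/-! ### Compactness of the reachable states and decisions -/

lemma continuous_stageObj {t : ℕ} {V : P.State (t + 1) → ℝ} (hV : Continuous V) (w : P.Om t) :
    Continuous (P.stageObj t V w) := by
  unfold stageObj
  exact (continuous_const.dotProduct continuous_id).add
    (hV.comp (continuous_const.matrix_mulVec continuous_id))

lemma eq_zero_of_recession {t : ℕ} {w : P.Om t} {R₀ : P.State t}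
    (hne : (P.feas t R₀ w).Nonempty) (hb : Bornology.IsBounded (P.feas t R₀ w))
    {d : P.Dec t} (hd : 0 ≤ d) (hA : P.A t w *ᵥ d = 0) : d = 0 := by
  by_contra hd0
  obtain ⟨x₀, hx₀, hx₀'⟩ := hne
  obtain ⟨C, hC⟩ := hb.exists_norm_le
  have hdn : 0 < ‖d‖ := norm_pos_iff.mpr hd0
  have hC0 : 0 ≤ C := (norm_nonneg _).trans (hC x₀ ⟨hx₀, hx₀'⟩)
  set s : ℝ := (C + ‖x₀‖ + 1) / ‖d‖ with hs
  have hs0 : 0 ≤ s := by positivity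
  have hmem : x₀ + s • d ∈ P.feas t R₀ w := by
    refine ⟨add_nonneg hx₀ (smul_nonneg hs0 hd), ?_⟩
    rw [Matrix.mulVec_add, Matrix.mulVec_smul, hA, smul_zero, add_zero, hx₀']
  have h1 := hC _ hmem
  have h2 : ‖s • d‖ = C + ‖x₀‖ + 1 := by
    rw [norm_smul, Real.norm_of_nonneg hs0, hs, div_mul_cancel₀ _ hdn.ne']
  have h3 : ‖s • d‖ ≤ ‖x₀ + s • d‖ + ‖x₀‖ := by
    simpa using norm_sub_le (x₀ + s • d) x₀
  linarith

/-- Since the recession cone of a feasible set does not depend on the resource state, boundedness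
of one nonempty feasible set gives a common bound over every bounded set of resource states. -/
lemma isBounded_feas_of_isBounded {t : ℕ} {w : P.Om t} {R₀ : P.State t}
    (hne : (P.feas t R₀ w).Nonempty) (hb : Bornology.IsBounded (P.feas t R₀ w))
    {K : Set (P.State t)} (hK : Bornology.IsBounded K) :
    Bornology.IsBounded {x | ∃ R ∈ K, x ∈ P.feas t R w} := by
  have hcpt : IsCompact (Metric.sphere (0 : P.Dec t) 1 ∩ {d | 0 ≤ d}) :=
    (isCompact_sphere _ _).inter_right isClosed_Ici
  have hcont : Continuous fun d : P.Dec t => ‖P.A t w *ᵥ d‖ :=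
    (continuous_const.matrix_mulVec continuous_id).norm
  obtain ⟨δ, hδ, hδ'⟩ := hcpt.exists_forall_le' hcont.continuousOn (a := 0) (by
    rintro d ⟨hd1, hd⟩
    rw [norm_pos_iff]
    intro h
    have := eq_zero_of_recession hne hb hd h
    simp [this] at hd1)
  obtain ⟨C, hC⟩ := hK.exists_norm_le
  rw [isBounded_iff_forall_norm_le]
  refine ⟨(‖P.b t w‖ + C) / δ, ?_⟩
  rintro x ⟨R, hR, hx, hx'⟩
  have hAx : P.A t w *ᵥ x = P.b t w - R := by rw [← hx']; abel
  have hle : ‖P.A t w *ᵥ x‖ ≤ ‖P.b t w‖ + C := by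
    rw [hAx]
    exact (norm_sub_le _ _).trans (by linarith [hC R hR])
  rw [le_div_iff₀ hδ]
  rcases eq_or_ne x 0 with rfl | hx0
  · simpa using (norm_nonneg _).trans hle
  have hxn : 0 < ‖x‖ := norm_pos_iff.mpr hx0
  have h := hδ' (‖x‖⁻¹ • x) ⟨by simp [norm_smul, hxn.ne'],
    smul_nonneg (inv_nonneg.mpr hxn.le) hx⟩
  rw [Matrix.mulVec_smul, norm_smul, norm_inv, norm_norm, inv_mul_eq_div, le_div_iff₀ hxn] at h
  linarith

/-- The feasible pairs of a state in `K` and a decision at outcome `w`. -/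
def feasGraph (P : MSLP) (t : ℕ) (w : P.Om t) (K : Set (P.State t)) :
    Set (P.State t × P.Dec t) :=
  {q | q.1 ∈ K ∧ q.2 ∈ P.feas t q.1 w}

lemma isCompact_feasGraph {t : ℕ} {w : P.Om t} {K : Set (P.State t)} (hK : IsCompact K)
    (hne : ∀ R ∈ K, (P.feas t R w).Nonempty)
    (hb : ∀ R ∈ K, Bornology.IsBounded (P.feas t R w)) : IsCompact (P.feasGraph t w K) := by
  rcases K.eq_empty_or_nonempty with rfl | ⟨R₀, hR₀⟩
  · simp [feasGraph]
  have hbd := isBounded_feas_of_isBounded (hne R₀ hR₀) (hb R₀ hR₀) hK.isBounded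
  refine Metric.isCompact_of_isClosed_isBounded ?_ ?_
  · have h1 : IsClosed {q : P.State t × P.Dec t | q.1 ∈ K} := hK.isClosed.preimage continuous_fst
    have h2 : IsClosed {q : P.State t × P.Dec t | 0 ≤ q.2} := isClosed_Ici.preimage continuous_snd
    have h3 : IsClosed {q : P.State t × P.Dec t | q.1 + P.A t w *ᵥ q.2 = P.b t w} :=
      isClosed_eq (continuous_fst.add (continuous_const.matrix_mulVec continuous_snd))
        continuous_const
    exact h1.inter (h2.inter h3)
  · refine (hK.isBounded.prod hbd).subset ?_
    rintro ⟨R, x⟩ ⟨hR, hx⟩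
    exact ⟨hR, R, hR, hx⟩

lemma isCompact_reach (hrec : P.RelativelyCompleteRecourse) (hbdd : P.BoundedFeasibleSets) :
    ∀ t, t ≤ P.T + 1 → IsCompact (P.reach t)
  | 0, _ => isCompact_singleton
  | t + 1, ht => by
    have ih := isCompact_reach hrec hbdd t (by omega)
    have h : P.reach (t + 1) = ⋃ w : P.Om t,
        (fun q : P.State t × P.Dec t => P.B t w *ᵥ q.2) '' P.feasGraph t w (P.reach t) := by
      ext R'
      simp only [reach, Set.mem_ofPred_eq, Set.mem_iUnion, Set.mem_image, feasGraph, Prod.exists]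
      constructor
      · rintro ⟨R, hR, w, x, hx, rfl⟩
        exact ⟨w, R, x, ⟨hR, hx⟩, rfl⟩
      · rintro ⟨w, R, x, ⟨hR, hx⟩, rfl⟩
        exact ⟨R, hR, w, x, hx, rfl⟩
    rw [h]
    exact isCompact_iUnion fun w =>
      (isCompact_feasGraph ih (fun R hR => hrec t (by omega) R hR w)
        (fun R hR => hbdd t (by omega) R hR w)).image
        (continuous_const.matrix_mulVec continuous_snd)

lemma isCompact_feasGraph_reach (hrec : P.RelativelyCompleteRecourse)
    (hbdd : P.BoundedFeasibleSets) {t : ℕ} (ht : t ≤ P.T) (w : P.Om t) :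
    IsCompact (P.feasGraph t w (P.reach t)) :=
  isCompact_feasGraph (isCompact_reach hrec hbdd t (by omega)) (fun R hR => hrec t ht R hR w)
    fun R hR => hbdd t ht R hR w

lemma isCompact_feas (hbdd : P.BoundedFeasibleSets) {t : ℕ} (ht : t ≤ P.T) {R : P.State t}
    (hR : R ∈ P.reach t) (w : P.Om t) : IsCompact (P.feas t R w) := by
  refine Metric.isCompact_of_isClosed_isBounded ?_ (hbdd t ht R hR w)
  exact isClosed_Ici.inter (isClosed_eq
    (continuous_const.add (continuous_const.matrix_mulVec continuous_id)) continuous_const)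

lemma reach_succ {t : ℕ} {R : P.State t} (hR : R ∈ P.reach t) {w : P.Om t} {x : P.Dec t}
    (hx : x ∈ P.feas t R w) : P.B t w *ᵥ x ∈ P.reach (t + 1) :=
  ⟨R, hR, w, x, hx, rfl⟩

/-! ### Stage values -/

lemma stageVal_le (hbdd : P.BoundedFeasibleSets) {t : ℕ} (ht : t ≤ P.T)
    {V : P.State (t + 1) → ℝ} (hV : Continuous V) {R : P.State t} (hR : R ∈ P.reach t)
    {w : P.Om t} {x : P.Dec t} (hx : x ∈ P.feas t R w) :
    P.stageVal t V R w ≤ P.stageObj t V w x :=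
  csInf_le ((isCompact_feas hbdd ht hR w).bddBelow_image (continuous_stageObj hV w).continuousOn)
    (Set.mem_image_of_mem _ hx)

lemma le_stageVal {t : ℕ} {V : P.State (t + 1) → ℝ} {R : P.State t} {w : P.Om t}
    (hne : (P.feas t R w).Nonempty) {v : ℝ} (h : ∀ x ∈ P.feas t R w, v ≤ P.stageObj t V w x) :
    v ≤ P.stageVal t V R w :=
  le_csInf (hne.image _) (Set.forall_mem_image.mpr h)

lemma IsArgmin.stageVal_eq {t : ℕ} {V : P.State (t + 1) → ℝ} {R : P.State t} {w : P.Om t}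
    {x : P.Dec t} (h : P.IsArgmin t R w (P.stageObj t V w) x) :
    P.stageVal t V R w = P.stageObj t V w x :=
  le_antisymm (csInf_le ⟨_, Set.forall_mem_image.mpr h.2⟩ (Set.mem_image_of_mem _ h.1))
    (le_stageVal ⟨x, h.1⟩ h.2)

lemma exists_isArgmin (hrec : P.RelativelyCompleteRecourse) (hbdd : P.BoundedFeasibleSets)
    {t : ℕ} (ht : t ≤ P.T) {V : P.State (t + 1) → ℝ} (hV : Continuous V) {R : P.State t}
    (hR : R ∈ P.reach t) (w : P.Om t) : ∃ x, P.IsArgmin t R w (P.stageObj t V w) x := by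
  obtain ⟨x, hx, hmin⟩ := (isCompact_feas hbdd ht hR w).exists_isMinOn (hrec t ht R hR w)
    (continuous_stageObj hV w).continuousOn
  exact ⟨x, hx, fun y hy => hmin hy⟩

/-- Limits of feasible decisions along an ultrafilter exist and are feasible in the limit state. -/
lemma exists_tendsto_feas (hrec : P.RelativelyCompleteRecourse) (hbdd : P.BoundedFeasibleSets)
    {t : ℕ} (ht : t ≤ P.T) {w : P.Om t} {U : Ultrafilter ℕ} {r : ℕ → P.State t} {R : P.State t}
    (hr : Tendsto r U (𝓝 R)) (hreach : ∀ k, r k ∈ P.reach t) {x : ℕ → P.Dec t}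
    (hx : ∀ᶠ k in U, x k ∈ P.feas t (r k) w) :
    ∃ y ∈ P.feas t R w, Tendsto x U (𝓝 y) := by
  obtain ⟨⟨R', y⟩, hmem, hle⟩ := (isCompact_feasGraph_reach hrec hbdd ht w).ultrafilter_le_nhds'
    (U.map fun k => (r k, x k)) (Ultrafilter.mem_map.mpr
      (mem_of_superset hx fun k hk => ⟨hreach k, hk⟩))
  have hT : Tendsto (fun k => (r k, x k)) U (𝓝 (R', y)) := hle
  have h1 : Tendsto r U (𝓝 R') := (continuous_fst.tendsto _).comp hT
  have h2 : Tendsto x U (𝓝 y) := (continuous_snd.tendsto _).comp hT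
  obtain rfl := tendsto_nhds_unique h1 hr
  exact ⟨y, hmem.2, h2⟩

/-- Lower semicontinuity of the stage value along an ultrafilter of reachable states. -/
lemma exists_tendsto_stageVal (hrec : P.RelativelyCompleteRecourse) (hbdd : P.BoundedFeasibleSets)
    {t : ℕ} (ht : t ≤ P.T) {V : P.State (t + 1) → ℝ} (hV : Continuous V) (w : P.Om t)
    {U : Ultrafilter ℕ} {r : ℕ → P.State t} {R : P.State t} (hr : Tendsto r U (𝓝 R))
    (hreach : ∀ k, r k ∈ P.reach t) (hR : R ∈ P.reach t) :
    ∃ v, P.stageVal t V R w ≤ v ∧ Tendsto (fun k => P.stageVal t V (r k) w) U (𝓝 v) := by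
  choose x hx using fun k => exists_isArgmin hrec hbdd ht hV (hreach k) w
  obtain ⟨y, hy, hxy⟩ := exists_tendsto_feas hrec hbdd ht hr hreach
    (Eventually.of_forall fun k => (hx k).1)
  refine ⟨P.stageObj t V w y, stageVal_le hbdd ht hV hR hy, ?_⟩
  simp_rw [fun k => (hx k).stageVal_eq]
  exact ((continuous_stageObj hV w).tendsto y).comp hxy

/-! ### Linear programming duality for the stage problems -/

section Duality

variable {t : ℕ} {w : P.Om t} {ι : Type} [Fintype ι] {g : ι → P.State (t + 1)} {a : ι → ℝ}
  {V : P.State (t + 1) → ℝ}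

lemma sum_mul_vecMul_dotProduct (l : ι → ℝ) (x : P.Dec t) :
    (fun i => ∑ j, l j * (g j ᵥ* P.B t w) i) ⬝ᵥ x = ∑ j, l j * (g j ⬝ᵥ P.B t w *ᵥ x) := by
  simp only [Matrix.dotProduct_mulVec]
  simp only [dotProduct, Finset.sum_mul, Finset.mul_sum, mul_assoc]
  exact Finset.sum_comm

/-- Weak duality. -/
lemma DualFeasible.dualObj_le (hV : ∀ j R, a j + g j ⬝ᵥ R ≤ V R) {u : P.State t} {l : ι → ℝ}
    (h : P.DualFeasible t w g u l) {R : P.State t} {x : P.Dec t} (hx : x ∈ P.feas t R w) :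
    P.dualObj t w a R u l ≤ P.stageObj t V w x := by
  obtain ⟨hl, hsum, hc⟩ := h
  obtain ⟨hx0, hxe⟩ := hx
  have hb : P.b t w - R = P.A t w *ᵥ x := by rw [← hxe]; abel
  have h1 : (u ᵥ* P.A t w) ⬝ᵥ x ≤
      (P.c t w + fun i => ∑ j, l j * (g j ᵥ* P.B t w) i) ⬝ᵥ x :=
    Finset.sum_le_sum fun i _ => mul_le_mul_of_nonneg_right (by
      have := hc i
      simp only [Pi.add_apply]
      linarith) (hx0 i)
  rw [add_dotProduct, sum_mul_vecMul_dotProduct] at h1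
  have h2 : ∑ j, l j * (g j ⬝ᵥ P.B t w *ᵥ x) + ∑ j, l j * a j ≤ V (P.B t w *ᵥ x) := by
    calc _ = ∑ j, l j * (a j + g j ⬝ᵥ P.B t w *ᵥ x) := by
          rw [← Finset.sum_add_distrib]
          exact Finset.sum_congr rfl fun j _ => by ring
      _ ≤ ∑ j, l j * V (P.B t w *ᵥ x) :=
          Finset.sum_le_sum fun j _ => mul_le_mul_of_nonneg_left (hV j _) (hl j)
      _ = V (P.B t w *ᵥ x) := by rw [← Finset.sum_mul, hsum, one_mul]
  rw [dualObj, stageObj, hb, Matrix.dotProduct_mulVec]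
  linarith

lemma nonneg_of_forall_le_add_mul {v C q : ℝ} (h : ∀ s : ℝ, 0 ≤ s → v ≤ C + s * q) : 0 ≤ q := by
  by_contra! hq
  have h0 := h 0 le_rfl
  have hs : 0 ≤ (C - v + 1) / -q := div_nonneg (by linarith) (by linarith)
  have h1 := h _ hs
  have h2 : (C - v + 1) / -q * q = -(C - v + 1) := by
    rw [div_neg, neg_mul, div_mul_cancel₀ _ hq.ne]
  linarith

/-- A finite system of affine functions on a convex set whose maximum is bounded below by `v` has
a convex combination bounded below by `v`. -/
lemma exists_weights_of_forall_exists_le {E : Type*} [AddCommGroup E] [Module ℝ E] {s : Set E}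
    (hs : Convex ℝ s) (hne : s.Nonempty) {F : E → ι → ℝ}
    (hF : ∀ x y : E, ∀ p q : ℝ, 0 ≤ p → 0 ≤ q → p + q = 1 →
      F (p • x + q • y) = p • F x + q • F y) {v : ℝ} (h : ∀ x ∈ s, ∃ j, v ≤ F x j) :
    ∃ l : ι → ℝ, (∀ j, 0 ≤ l j) ∧ ∑ j, l j = 1 ∧ ∀ x ∈ s, v ≤ ∑ j, l j * F x j := by
  classical
  -- separate the vectors below `v` from those that dominate some `F x`
  set O : Set (ι → ℝ) := {z | ∀ j, z j < v} with hO
  set C : Set (ι → ℝ) := {z | ∃ x ∈ s, F x ≤ z} with hC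
  have hOconv : Convex ℝ O := by
    intro y hy z hz p q hp hq hpq j
    have : p • y j + q • z j ∈ Set.Iio v := convex_Iio v (hy j) (hz j) hp hq hpq
    simpa using this
  have hOopen : IsOpen O := by
    have : O = ⋂ j, {z : ι → ℝ | z j < v} := by ext; simp [hO]
    rw [this]
    exact isOpen_iInter_of_finite fun j => isOpen_lt (continuous_apply j) continuous_const
  have hCconv : Convex ℝ C := by
    rintro y ⟨x, hx, hxy⟩ z ⟨x', hx', hxz⟩ p q hp hq hpq
    refine ⟨_, hs hx hx' hp hq hpq, ?_⟩
    rw [hF x x' p q hp hq hpq]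
    exact add_le_add (smul_le_smul_of_nonneg_left hxy hp) (smul_le_smul_of_nonneg_left hxz hq)
  have hdisj : Disjoint O C := by
    rw [Set.disjoint_left]
    rintro z hz ⟨x, hx, hxz⟩
    obtain ⟨j, hj⟩ := h x hx
    exact absurd (hz j) (not_lt.mpr (hj.trans (hxz j)))
  obtain ⟨f, θ, hfO, hfC⟩ := geometric_hahn_banach_open hOconv hOopen hCconv hdisj
  set l : ι → ℝ := fun j => f (Pi.single j 1) with hl
  have hf : ∀ z, f z = ∑ j, l j * z j := by
    intro z
    conv_lhs => rw [← Finset.univ_sum_single z]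
    rw [map_sum]
    refine Finset.sum_congr rfl fun j _ => ?_
    have : Pi.single j (z j) = z j • (Pi.single j 1 : ι → ℝ) := by
      rw [← Pi.single_smul, smul_eq_mul, mul_one]
    rw [this, map_smul, smul_eq_mul, mul_comm]
  have hconst : ∀ ε : ℝ, 0 < ε → (fun _ : ι => v - ε) ∈ O := fun ε hε j => by
    show v - ε < v
    linarith
  have hl0 : ∀ j, 0 ≤ l j := by
    intro j
    refine nonneg_of_forall_le_add_mul (v := - θ) (C := - f (fun _ => v - 1)) fun r hr => ?_
    have hmem : (fun _ : ι => v - 1) - r • (Pi.single j 1 : ι → ℝ) ∈ O := by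
      intro i
      have h0 : (0 : ℝ) ≤ (Pi.single j 1 : ι → ℝ) i := by
        by_cases hij : i = j
        · subst hij; simp
        · simp [hij]
      have := mul_nonneg hr h0
      simp only [Pi.sub_apply, Pi.smul_apply, smul_eq_mul]
      linarith
    have := hfO _ hmem
    rw [map_sub, map_smul, smul_eq_mul] at this
    simp only [hl]
    linarith
  have hsum0 : 0 ≤ ∑ j, l j := Finset.sum_nonneg fun j _ => hl0 j
  have hsumpos : 0 < ∑ j, l j := by
    refine lt_of_le_of_ne hsum0 fun h0 => ?_
    have hz : ∀ j, l j = 0 := fun j =>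
      (Finset.sum_eq_zero_iff_of_nonneg fun j _ => hl0 j).mp h0.symm j (Finset.mem_univ j)
    obtain ⟨x, hx⟩ := hne
    have h1 := hfO _ (hconst 1 one_pos)
    have h2 := hfC _ ⟨x, hx, le_rfl⟩
    rw [hf] at h1 h2
    simp only [hz, zero_mul, Finset.sum_const_zero] at h1 h2
    linarith
  have hθ : (∑ j, l j) * v ≤ θ := by
    refine le_of_forall_pos_lt_add fun ε hε => ?_
    have h1 := hfO _ (hconst (ε / ∑ j, l j) (div_pos hε hsumpos))
    rw [hf, ← Finset.sum_mul, mul_sub, mul_div_cancel₀ _ hsumpos.ne'] at h1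
    linarith
  refine ⟨fun j => l j / ∑ i, l i, fun j => div_nonneg (hl0 j) hsum0, ?_, fun x hx => ?_⟩
  · rw [← Finset.sum_div, div_self hsumpos.ne']
  · have h2 := hfC _ ⟨x, hx, le_rfl⟩
    rw [hf] at h2
    have h3 : ∑ j, l j / (∑ i, l i) * F x j = (∑ j, l j * F x j) / ∑ i, l i := by
      rw [Finset.sum_div]
      exact Finset.sum_congr rfl fun j _ => by ring
    rw [h3, le_div_iff₀ hsumpos]
    linarith

/-- If the Lagrangian at the multipliers `u` is bounded below by `v` on the nonnegative orthant,
then `u` extends to a dual feasible point of value at least `v`. -/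
lemma exists_dualFeasible_of_lagrangian (hV : ∀ R, ∃ j, V R = a j + g j ⬝ᵥ R) {R u : P.State t}
    {v : ℝ} (h : ∀ x : P.Dec t, 0 ≤ x →
      v ≤ u ⬝ᵥ (P.b t w - P.A t w *ᵥ x - R) + P.stageObj t V w x) :
    ∃ l : ι → ℝ, P.DualFeasible t w g u l ∧ v ≤ P.dualObj t w a R u l := by
  set F : P.Dec t → ι → ℝ := fun x j =>
    u ⬝ᵥ (P.b t w - R) + a j + (P.c t w ⬝ᵥ x - (u ᵥ* P.A t w) ⬝ᵥ x + g j ⬝ᵥ P.B t w *ᵥ x) with hF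
  obtain ⟨l, hl0, hl1, hl⟩ := exists_weights_of_forall_exists_le (ι := ι) (F := F) (v := v)
    (convex_Ici (0 : P.Dec t)) ⟨0, Set.mem_Ici.mpr le_rfl⟩ (by
      intro x y p q _ _ hpq
      funext j
      simp only [hF, Pi.add_apply, Pi.smul_apply, smul_eq_mul, dotProduct_add, dotProduct_smul,
        Matrix.mulVec_add, Matrix.mulVec_smul]
      linear_combination (-(u ⬝ᵥ (P.b t w - R)) - a j) * hpq) (by
      intro x hx
      obtain ⟨j, hj⟩ := hV (P.B t w *ᵥ x)
      refine ⟨j, (h x hx).trans (le_of_eq ?_)⟩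
      simp only [hF, stageObj, hj, dotProduct_sub, Matrix.dotProduct_mulVec]
      ring)
  have hl' : ∀ x : P.Dec t, 0 ≤ x → v ≤ P.dualObj t w a R u l +
      (P.c t w - u ᵥ* P.A t w + fun i => ∑ j, l j * (g j ᵥ* P.B t w) i) ⬝ᵥ x := by
    intro x hx
    refine (hl x hx).trans (le_of_eq ?_)
    rw [add_dotProduct, sub_dotProduct, sum_mul_vecMul_dotProduct, dualObj]
    simp only [hF, mul_add, Finset.sum_add_distrib, ← Finset.sum_mul, hl1, one_mul]
  refine ⟨l, ⟨hl0, hl1, fun i => ?_⟩, by simpa using hl' 0 le_rfl⟩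
  have := nonneg_of_forall_le_add_mul fun s hs => by
    have := hl' (Pi.single i s) (Pi.single_nonneg.mpr hs)
    rw [dotProduct_single, mul_comm _ s] at this
    exact this
  simp only [Pi.add_apply, Pi.sub_apply] at this
  linarith

/-- Strong duality in the form needed for cuts: if the negative of the equality multipliers of a
dual optimal solution is a subgradient of the stage value, then the dual optimal value is the stage
value. -/
lemma stageVal_eq_dualObj (hV : ∀ j R, a j + g j ⬝ᵥ R ≤ V R)
    (hV' : ∀ R, ∃ j, V R = a j + g j ⬝ᵥ R) {R u : P.State t} {l : ι → ℝ}
    (hne : (P.feas t R w).Nonempty) (hb : Bornology.IsBounded (P.feas t R w)) (hVc : Continuous V)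
    (hopt : P.DualBasicOptimal t w g a R u l)
    (hsub : ∀ R', (P.feas t R' w).Nonempty →
      P.stageVal t V R w + (-u) ⬝ᵥ (R' - R) ≤ P.stageVal t V R' w) :
    P.stageVal t V R w = P.dualObj t w a R u l := by
  refine le_antisymm ?_ (le_stageVal hne fun x hx => hopt.1.dualObj_le hV hx)
  obtain ⟨l', hl', hv⟩ := exists_dualFeasible_of_lagrangian (w := w) hV' (R := R) (u := u)
    (v := P.stageVal t V R w) (by
      intro x hx
      -- every `x ≥ 0` is feasible for the resource state `b - A x`
      have hmem : x ∈ P.feas t (P.b t w - P.A t w *ᵥ x) w := ⟨hx, by abel⟩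
      have h1 := hsub _ ⟨x, hmem⟩
      -- the state need not be reachable: an unbounded infimum, with its junk value, is excluded
      -- because all nonempty feasible sets have the same recession cone
      have hbd : Bornology.IsBounded (P.feas t (P.b t w - P.A t w *ᵥ x) w) :=
        (isBounded_feas_of_isBounded hne hb Bornology.isBounded_singleton).subset
          fun y hy => ⟨_, rfl, hy⟩
      have hcl : IsClosed (P.feas t (P.b t w - P.A t w *ᵥ x) w) :=
        isClosed_Ici.inter (isClosed_eq
          (continuous_const.add (continuous_const.matrix_mulVec continuous_id)) continuous_const)
      have h2 : P.stageVal t V (P.b t w - P.A t w *ᵥ x) w ≤ P.stageObj t V w x :=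
        csInf_le ((Metric.isCompact_of_isClosed_isBounded hcl hbd).bddBelow_image
          (continuous_stageObj hVc w).continuousOn) (Set.mem_image_of_mem _ hmem)
      rw [neg_dotProduct] at h1
      linarith)
  exact hv.trans (hopt.2.2 u l' hl')

end Duality

/-! ### Finiteness of the cuts -/

open Classical in
/-- Total weight that `l` puts on each fibre of `π`. -/
noncomputable def aggregate {ι κ : Type} [Fintype ι] (π : ι → κ) (l : ι → ℝ) (q : κ) : ℝ :=
  ∑ j with π j = q, l j

lemma sum_aggregate_mul {ι κ : Type} [Fintype ι] [Fintype κ] (π : ι → κ) (l : ι → ℝ) (f : κ → ℝ) :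
    ∑ q, aggregate π l q * f q = ∑ j, l j * f (π j) := by
  classical
  rw [← Finset.sum_fiberwise Finset.univ π]
  refine Finset.sum_congr rfl fun q _ => ?_
  rw [aggregate, Finset.sum_mul]
  refine Finset.sum_congr (by congr) fun j hj => ?_
  rw [(Finset.mem_filter.mp hj).2]

/-- Dual basic solutions for families of cuts with slopes drawn, with repetitions, from the finite
family `g`; the multipliers of repeated cuts are added up. -/
def basicSolutions (P : MSLP) (t : ℕ) (w : P.Om t) {κ : Type} (g : κ → P.State (t + 1)) :
    Set (P.State t × (κ → ℝ)) :=
  {q | ∃ (ι : Type) (_ : Fintype ι) (π : ι → κ) (l : ι → ℝ), ∑ j, l j = 1 ∧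
    P.DualBasic t w (fun j => g (π j)) q.1 l ∧ q.2 = aggregate π l}

/-- A dual basic solution is determined by its vanishing coordinates and active constraints; this
remains true after adding up the multipliers of repeated cuts. -/
lemma finite_basicSolutions (t : ℕ) (w : P.Om t) {κ : Type} [Fintype κ]
    (g : κ → P.State (t + 1)) : (P.basicSolutions t w g).Finite := by
  classical
  let lhs : P.State t × (κ → ℝ) → Fin (P.n t) → ℝ := fun q i =>
    (q.1 ᵥ* P.A t w) i - ∑ c, q.2 c * (g c ᵥ* P.B t w) i
  refine Set.Finite.of_injOn
    (f := fun q : P.State t × (κ → ℝ) => (Finset.univ.filter fun r => q.1 r = 0,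
      Finset.univ.filter fun c => q.2 c = 0, Finset.univ.filter fun i => lhs q i = P.c t w i))
    (t := Set.univ) (fun _ _ => Set.mem_univ _) ?_ Set.finite_univ
  rintro ⟨u, L⟩ ⟨ι, _, π, l, hl, hbas, hL⟩ ⟨u₂, L₂⟩ ⟨ι₂, _, π₂, l₂, hl₂, -, hL₂⟩ heq
  simp only [Prod.mk.injEq, Finset.ext_iff, Finset.mem_filter_univ] at heq hL hL₂
  obtain ⟨h1, h2, h3⟩ := heq
  -- the difference of the aggregated multipliers, distributed proportionally over the fibres
  set l' : ι → ℝ := fun j => l j * ((L₂ (π j) - L (π j)) / L (π j)) with hl'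
  have hagg : aggregate π l' = L₂ - L := by
    funext c
    have : aggregate π l' c = L c * ((L₂ c - L c) / L c) := by
      rw [hL, aggregate, aggregate, Finset.sum_mul]
      refine Finset.sum_congr rfl fun j hj => ?_
      rw [hl', hL, ← (Finset.mem_filter.mp hj).2]
      rfl
    rw [this]
    by_cases hc : L c = 0
    · simp [hc, (h2 c).mp hc]
    · rw [mul_div_cancel₀ _ hc]; rfl
  have hsumL : ∑ c, L c = 1 := by
    have := sum_aggregate_mul π l fun _ => 1
    simpa [hl, ← hL] using this
  have hsumL₂ : ∑ c, L₂ c = 1 := by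
    have := sum_aggregate_mul π₂ l₂ fun _ => 1
    simpa [hl₂, ← hL₂] using this
  obtain ⟨hu, hl0⟩ := hbas (u₂ - u) l' (fun r (hr : u r = 0) => by simp [hr, (h1 r).mp hr])
    (fun j hj => by simp [hl', hj]) (by
      have := sum_aggregate_mul π l' fun _ => 1
      simpa [hagg, hsumL, hsumL₂] using this.symm) (by
      intro i hi
      have e1 := sum_aggregate_mul π l fun c => (g c ᵥ* P.B t w) i
      have e2 := sum_aggregate_mul π l' fun c => (g c ᵥ* P.B t w) i
      rw [← hL] at e1
      have hi1 : lhs (u, L) i = P.c t w i := by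
        simp only [lhs, e1]
        exact hi
      have hi2 := (h3 i).mp hi1
      rw [← e2, hagg]
      simp only [lhs] at hi1 hi2
      simp only [Matrix.sub_vecMul, Pi.sub_apply, sub_mul, Finset.sum_sub_distrib]
      linarith)
  have hLL : L₂ - L = 0 := by
    rw [← hagg, hl0]
    funext c
    simp [aggregate]
  rw [Prod.mk.injEq]
  exact ⟨(sub_eq_zero.mp hu).symm, (sub_eq_zero.mp hLL).symm⟩

/-! ### Eventual stabilization of the approximations -/

lemma Vstar_T (R : P.State (P.T + 1)) : P.Vstar P.T R = 0 := by
  have : {v | ∃ X : P.Policy, P.FeasibleFrom X (P.T + 1) R ∧ v = P.expCost X (P.T + 1) R} =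
      {0} := by
    ext v
    simp only [FeasibleFrom, expCost, Nat.sub_self, PathFeasible, pathCost, mul_zero,
      Finset.sum_const_zero, implies_true, true_and, Set.mem_ofPred_eq, Set.mem_singleton_iff]
    exact ⟨fun ⟨_, h⟩ => h, fun h => ⟨0, h⟩⟩
  rw [Vstar, this, csInf_singleton]

namespace Trace

variable {τ : P.Trace}

/-- The constant term `h^k_t(0)` of a cut. -/
def offset (τ : P.Trace) (k t : ℕ) : ℝ := τ.α k t - τ.slope k t ⬝ᵥ τ.resource k t

lemma cut_eq (k t : ℕ) (R : P.State (t + 1)) :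
    τ.cut k t R = τ.offset k t + τ.slope k t ⬝ᵥ R := by
  rw [cut, offset, dotProduct_sub]
  ring

lemma Vbar_T (k : ℕ) (R : P.State (P.T + 1)) : τ.Vbar k P.T R = 0 := by
  simp [Vbar, Vstar_T]

lemma cut_le_Vbar {j k t : ℕ} (hjk : j ≤ k) (ht : t < P.T) (R : P.State (t + 1)) :
    τ.cut j t R ≤ τ.Vbar k t R := by
  rw [Vbar, if_pos ht]
  exact Finset.le_sup' (fun j => τ.cut j t R) (Finset.mem_range.mpr (by omega))

lemma exists_Vbar_eq_cut (k : ℕ) {t : ℕ} (ht : t < P.T) (R : P.State (t + 1)) :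
    ∃ j ≤ k, τ.Vbar k t R = τ.cut j t R := by
  rw [Vbar, if_pos ht]
  obtain ⟨j, hj, h⟩ := Finset.exists_mem_eq_sup' (Finset.nonempty_range_add_one (n := k))
    (fun j => τ.cut j t R)
  exact ⟨j, by simpa [Nat.lt_succ_iff] using hj, h⟩

lemma Vbar_mono {j k t : ℕ} (hjk : j ≤ k) (ht : t ≤ P.T) (R : P.State (t + 1)) :
    τ.Vbar j t R ≤ τ.Vbar k t R := by
  rcases ht.lt_or_eq with h | rfl
  · obtain ⟨i, hi, h'⟩ := exists_Vbar_eq_cut (τ := τ) j h R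
    rw [h']
    exact cut_le_Vbar (hi.trans hjk) h R
  · simp [Vbar_T]

lemma continuous_Vbar (k : ℕ) {t : ℕ} (ht : t ≤ P.T) : Continuous (τ.Vbar k t) := by
  rcases ht.lt_or_eq with h | rfl
  · have : τ.Vbar k t = fun R => (Finset.range (k + 1)).sup' Finset.nonempty_range_add_one
        (fun j => τ.cut j t R) := by
      funext R
      rw [Vbar, if_pos h]
    rw [this]
    refine Continuous.finset_sup'_apply _ fun j _ => ?_
    have hj : τ.cut j t = fun R => τ.offset j t + τ.slope j t ⬝ᵥ R := funext (cut_eq j t)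
    change Continuous (τ.cut j t)
    rw [hj]
    exact continuous_const.add (continuous_const.dotProduct continuous_id)
  · have : τ.Vbar k P.T = fun _ => 0 := funext fun R => Vbar_T k R
    rw [this]
    exact continuous_const

section Run

variable {Q : ∀ t, Matrix (Fin (P.m (t + 1))) (Fin (P.m (t + 1))) ℝ} {ρ : ℕ → ℝ}

lemma IsRun.entering_mem_reach (h : τ.IsRun Q ρ) (k : ℕ) :
    ∀ t, t ≤ P.T + 1 → τ.entering k t ∈ P.reach t
  | 0, _ => rfl
  | t + 1, ht => reach_succ (h.entering_mem_reach k t (by omega)) (h.forward k t (by omega)).1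

lemma IsRun.resource_mem_reach (h : τ.IsRun Q ρ) (k : ℕ) {t : ℕ} (ht : t ≤ P.T) :
    τ.resource k t ∈ P.reach (t + 1) :=
  h.entering_mem_reach k (t + 1) (by omega)

/-- If the cuts of stage `t + 1` are finitely many, then so are the multiplier vectors and dual
values from which the cuts of stage `t` are built. -/
lemma IsRun.exists_finite_dualData (h : τ.IsRun Q ρ) (hd : τ.UsesDualBasic)
    (hrec : P.RelativelyCompleteRecourse) (hbdd : P.BoundedFeasibleSets) {t : ℕ} (ht : t < P.T)
    (hfin : t + 1 < P.T →
      (Set.range fun k => (τ.slope k (t + 1), τ.offset k (t + 1))).Finite)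
    (w : P.Om (t + 1)) :
    ∃ F : Set (P.State (t + 1) × ℝ), F.Finite ∧ ∀ k, ∃ q ∈ F, τ.β k t w = -q.1 ∧
      P.stageVal (t + 1) (τ.Vbar k (t + 1)) (τ.resource k t) w =
        q.1 ⬝ᵥ (P.b (t + 1) w - τ.resource k t) + q.2 := by
  have hne : ∀ k, (P.feas (t + 1) (τ.resource k t) w).Nonempty := fun k =>
    hrec (t + 1) ht _ (h.resource_mem_reach k ht.le) w
  have hb : ∀ k, Bornology.IsBounded (P.feas (t + 1) (τ.resource k t) w) := fun k =>
    hbdd (t + 1) ht _ (h.resource_mem_reach k ht.le) w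
  have hc : ∀ k, Continuous (τ.Vbar k (t + 1)) := fun k => continuous_Vbar k ht
  by_cases ht' : t + 1 < P.T
  · have := (hfin ht').fintype
    let κ := Set.range fun k => (τ.slope k (t + 1), τ.offset k (t + 1))
    let g : κ → P.State (t + 1 + 1) := fun q => q.1.1
    let a : κ → ℝ := fun q => q.1.2
    refine ⟨_, (finite_basicSolutions (t + 1) w g).image fun q => (q.1, ∑ c, q.2 c * a c),
      fun k => ?_⟩
    have hk := hd k t ht w
    rw [if_pos ht'] at hk
    obtain ⟨u, l, hopt, hβ⟩ := hk
    let π : Fin (k + 1) → κ := fun j => ⟨_, Set.mem_range_self (j : ℕ)⟩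
    refine ⟨_, Set.mem_image_of_mem _ (x := (u, aggregate π l))
      ⟨Fin (k + 1), inferInstance, π, l, hopt.1.2.1, hopt.2.1, rfl⟩, hβ, ?_⟩
    have hsub := h.subgradient k t ht w
    rw [hβ] at hsub
    rw [stageVal_eq_dualObj (fun j R => ?_) (fun R => ?_) (hne k) (hb k) (hc k) hopt hsub]
    · simp only [sum_aggregate_mul]
      rfl
    · exact (cut_eq (τ := τ) j (t + 1) R).symm.le.trans (cut_le_Vbar (by omega) ht' R)
    · obtain ⟨j, hj, h'⟩ := exists_Vbar_eq_cut (τ := τ) k ht' R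
      exact ⟨⟨j, by omega⟩, h'.trans (cut_eq j (t + 1) R)⟩
  · have hT : t + 1 = P.T := by omega
    have hV : ∀ k R, τ.Vbar k (t + 1) R = 0 := by
      intro k
      rw [hT]
      exact Vbar_T k
    refine ⟨_, (finite_basicSolutions (t + 1) w fun _ : Unit => 0).image fun q => (q.1, 0),
      fun k => ?_⟩
    have hk := hd k t ht w
    rw [if_neg ht'] at hk
    obtain ⟨u, l, hopt, hβ⟩ := hk
    refine ⟨_, Set.mem_image_of_mem _ (x := (u, aggregate id l))
      ⟨Unit, inferInstance, id, l, hopt.1.2.1, hopt.2.1, rfl⟩, hβ, ?_⟩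
    have hsub := h.subgradient k t ht w
    rw [hβ] at hsub
    rw [stageVal_eq_dualObj (fun j R => ?_) (fun R => ⟨(), ?_⟩) (hne k) (hb k) (hc k) hopt hsub]
    · simp [dualObj]
    · simp [hV]
    · simp [hV]

lemma IsRun.finite_range_cutData (h : τ.IsRun Q ρ) (hd : τ.UsesDualBasic)
    (hrec : P.RelativelyCompleteRecourse) (hbdd : P.BoundedFeasibleSets) {t : ℕ} (ht : t < P.T) :
    (Set.range fun k => (τ.slope k t, τ.offset k t)).Finite := by
  choose F hF hF' using h.exists_finite_dualData hd hrec hbdd ht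
    fun h' => h.finite_range_cutData hd hrec hbdd h'
  refine ((Set.Finite.pi' hF).image fun q : P.Om (t + 1) → P.State (t + 1) × ℝ =>
    (-∑ w, P.p (t + 1) w • (q w).1,
      ∑ w, P.p (t + 1) w * ((q w).1 ⬝ᵥ P.b (t + 1) w + (q w).2))).subset ?_
  rintro _ ⟨k, rfl⟩
  choose q hq hβ hval using fun w => hF' w k
  have hslope : τ.slope k t = -∑ w, P.p (t + 1) w • (q w).1 := by
    simp only [slope, hβ, smul_neg, Finset.sum_neg_distrib]
  refine ⟨q, hq, Prod.ext hslope.symm ?_⟩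
  simp only [offset, hslope, h.intercept k t ht, hval, neg_dotProduct, sum_dotProduct,
    smul_dotProduct, sub_neg_eq_add, dotProduct_sub, smul_eq_mul, ← Finset.sum_add_distrib]
  exact Finset.sum_congr rfl fun w _ => by ring
termination_by P.T - t

lemma exists_index_forall_exists_le_eq {γ : Type*} {f : ℕ → γ} (h : (Set.range f).Finite) :
    ∃ K, ∀ k, ∃ j ≤ K, f j = f k := by
  choose g hg using fun y : Set.range f => y.2
  have := h.fintype
  refine ⟨Finset.univ.sup g, fun k => ⟨g ⟨f k, k, rfl⟩, Finset.le_sup (Finset.mem_univ _), ?_⟩⟩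
  exact hg ⟨f k, k, rfl⟩

/-- Only finitely many cuts are ever generated, so the approximations are eventually constant. -/
lemma IsRun.exists_forall_Vbar_eq (h : τ.IsRun Q ρ) (hd : τ.UsesDualBasic)
    (hrec : P.RelativelyCompleteRecourse) (hbdd : P.BoundedFeasibleSets) :
    ∃ K, ∀ k, K ≤ k → ∀ t, t ≤ P.T → τ.Vbar k t = τ.Vbar K t := by
  have hex : ∀ t, ∃ K, t < P.T → ∀ k, ∃ j ≤ K,
      (τ.slope j t, τ.offset j t) = (τ.slope k t, τ.offset k t) := by
    intro t
    by_cases ht : t < P.T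
    · obtain ⟨K, hK⟩ := exists_index_forall_exists_le_eq (h.finite_range_cutData hd hrec hbdd ht)
      exact ⟨K, fun _ => hK⟩
    · exact ⟨0, fun h' => absurd h' ht⟩
  choose K hK using hex
  refine ⟨(Finset.range P.T).sup K, fun k hk t ht => funext fun R => ?_⟩
  refine le_antisymm ?_ (Vbar_mono hk ht R)
  rcases ht.lt_or_eq with ht' | rfl
  · obtain ⟨i, -, hi⟩ := exists_Vbar_eq_cut (τ := τ) k ht' R
    obtain ⟨j, hj, hji⟩ := hK t ht' i
    rw [Prod.mk.injEq] at hji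
    rw [hi, cut_eq, ← hji.1, ← hji.2, ← cut_eq]
    exact cut_le_Vbar (hj.trans (Finset.le_sup (Finset.mem_range.mpr ht'))) ht' R
  · simp [Vbar_T]

end Run

end Trace

/-! ### Expected costs of policies -/

lemma pathCost_congr (X : P.Policy) {ω ω' : P.Realization} :
    ∀ (d t : ℕ) (R : P.State t), (∀ s, t ≤ s → ω s = ω' s) →
      P.pathCost X ω d t R = P.pathCost X ω' d t R
  | 0, _, _, _ => rfl
  | d + 1, t, R, h => by
    rw [pathCost, pathCost, h t le_rfl,
      pathCost_congr X d (t + 1) _ fun s hs => h s (by omega)]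

lemma pathFeasible_congr (X : P.Policy) {ω ω' : P.Realization} :
    ∀ (d t : ℕ) (R : P.State t), (∀ s, t ≤ s → ω s = ω' s) →
      (P.PathFeasible X ω d t R ↔ P.PathFeasible X ω' d t R)
  | 0, _, _, _ => Iff.rfl
  | d + 1, t, R, h => by
    rw [PathFeasible, PathFeasible, h t le_rfl,
      pathFeasible_congr X d (t + 1) _ fun s hs => h s (by omega)]

lemma feasibleFrom_iff (X : P.Policy) {t : ℕ} (ht : t ≤ P.T) (R : P.State t) :
    P.FeasibleFrom X t R ↔ ∀ w, X t R w ∈ P.feas t R w ∧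
      P.FeasibleFrom X (t + 1) (P.B t w *ᵥ X t R w) := by
  have hd : P.T + 1 - t = (P.T + 1 - (t + 1)) + 1 := by omega
  simp only [FeasibleFrom, hd, PathFeasible]
  constructor
  · intro h w
    have key : ∀ ω : P.Realization, X t R w ∈ P.feas t R w ∧
        P.PathFeasible X ω (P.T + 1 - (t + 1)) (t + 1) (P.B t w *ᵥ X t R w) := by
      intro ω
      have := h (Function.update ω t w)
      rw [Function.update_self] at this
      refine ⟨this.1, (pathFeasible_congr X _ _ _ fun s hs => ?_).mp this.2⟩
      rw [Function.update_of_ne (by omega)]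
    exact ⟨(key fun s => ⟨0, P.N_pos s⟩).1, fun ω => (key ω).2⟩
  · exact fun h ω => ⟨(h (ω t)).1, (h (ω t)).2 ω⟩

/-- Integrating out the outcome of stage `i` in a function whose second argument does not depend
on that outcome. -/
lemma sum_scenarioProb_mul (i : Fin (P.T + 1)) (F : P.Om i → P.Scenario → ℝ)
    (hF : ∀ w (ω ω' : P.Scenario), (∀ j, j ≠ i → ω j = ω' j) → F w ω = F w ω') :
    ∑ ω, P.scenarioProb ω * F (ω i) ω =
      ∑ w, P.p i w * ∑ ω, P.scenarioProb ω * F w ω := by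
  have hprob : ∀ w (r : ∀ j : Fin P.T, P.Om (i.succAbove j)),
      P.scenarioProb (i.insertNth (α := fun t : Fin (P.T + 1) => P.Om t) w r) =
        P.p i w * ∏ j, P.p (i.succAbove j) (r j) := by
    intro w r
    rw [scenarioProb, Fin.prod_univ_succAbove _ i]
    simp only [Fin.insertNth_apply_same, Fin.insertNth_apply_succAbove]
  have hsplit : ∀ G : P.Scenario → ℝ, ∑ ω, G ω =
      ∑ w, ∑ r, G (i.insertNth (α := fun t : Fin (P.T + 1) => P.Om t) w r) := by
    intro G
    rw [← (Fin.insertNthEquiv (fun t : Fin (P.T + 1) => P.Om t) i).sum_comp G,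
      Fintype.sum_prod_type]
    rfl
  have hind : ∀ w w' (r : ∀ j : Fin P.T, P.Om (i.succAbove j)),
      F w (i.insertNth (α := fun t : Fin (P.T + 1) => P.Om t) w' r) =
        F w (i.insertNth (α := fun t : Fin (P.T + 1) => P.Om t) w r) := by
    intro w w' r
    refine hF _ _ _ fun j hj => ?_
    obtain ⟨k, rfl⟩ := Fin.exists_succAbove_eq hj
    simp only [Fin.insertNth_apply_succAbove]
  rw [hsplit]
  refine Finset.sum_congr rfl fun w _ => ?_
  rw [hsplit]
  simp only [hprob, hind w, Fin.insertNth_apply_same, mul_assoc, ← Finset.mul_sum]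
  rw [← Finset.sum_mul, P.p_sum i (Nat.lt_succ_iff.mp i.2), one_mul]

lemma sum_scenarioProb : ∑ ω, P.scenarioProb ω = 1 := by
  simp only [scenarioProb]
  rw [← Fintype.prod_sum]
  exact Finset.prod_eq_one fun i _ => P.p_sum i (Nat.lt_succ_iff.mp i.2)

lemma expCost_eq (X : P.Policy) {t : ℕ} (ht : t ≤ P.T) (R : P.State t) :
    P.expCost X t R = ∑ w, P.p t w * (P.c t w ⬝ᵥ X t R w +
      P.expCost X (t + 1) (P.B t w *ᵥ X t R w)) := by
  have hd : P.T + 1 - t = (P.T + 1 - (t + 1)) + 1 := by omega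
  have hlt : t < P.T + 1 := by omega
  have hext : ∀ ω : P.Scenario, P.extend ω t = ω ⟨t, hlt⟩ := fun ω => by
    rw [extend, dif_pos hlt]
  have := sum_scenarioProb_mul (P := P) ⟨t, hlt⟩
    (fun w ω => P.c t w ⬝ᵥ X t R w +
      P.pathCost X (P.extend ω) (P.T + 1 - (t + 1)) (t + 1) (P.B t w *ᵥ X t R w)) (by
      intro w ω ω' h
      rw [pathCost_congr X _ _ _ fun s hs => ?_]
      unfold extend
      split_ifs with h'
      · exact h ⟨s, h'⟩ (by simp only [ne_eq, Fin.mk.injEq]; omega)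
      · rfl)
  rw [expCost, hd]
  simp only [pathCost, hext]
  rw [this]
  refine Finset.sum_congr rfl fun w _ => ?_
  simp only [mul_add, Finset.sum_add_distrib, ← Finset.sum_mul, sum_scenarioProb, one_mul, expCost]

lemma expCost_T_succ (X : P.Policy) (R : P.State (P.T + 1)) : P.expCost X (P.T + 1) R = 0 := by
  simp [expCost, pathCost]

lemma p_pos (hpos : ∀ ω : P.Scenario, 0 < P.scenarioProb ω) {t : ℕ} (ht : t ≤ P.T)
    (w : P.Om t) : 0 < P.p t w := by
  refine lt_of_le_of_ne (P.p_nonneg t ht w) fun h0 => ?_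
  have hlt : t < P.T + 1 := by omega
  let ω : P.Scenario := Function.update (fun s => ⟨0, P.N_pos s⟩) (⟨t, hlt⟩ : Fin (P.T + 1)) w
  refine (hpos ω).ne' (Finset.prod_eq_zero (Finset.mem_univ (⟨t, hlt⟩ : Fin (P.T + 1))) ?_)
  simp only [ω, Function.update_self]
  exact h0.symm

/-! ### Validity of the cuts -/

namespace Trace

variable {τ : P.Trace} {Q : ∀ t, Matrix (Fin (P.m (t + 1))) (Fin (P.m (t + 1))) ℝ} {ρ : ℕ → ℝ}

lemma IsRun.cut_le (h : τ.IsRun Q ρ) (hrec : P.RelativelyCompleteRecourse) (k : ℕ) {t : ℕ}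
    (ht : t < P.T) {R : P.State (t + 1)} (hR : R ∈ P.reach (t + 1)) :
    τ.cut k t R ≤ ∑ w, P.p (t + 1) w * P.stageVal (t + 1) (τ.Vbar k (t + 1)) R w := by
  rw [cut, h.intercept k t ht, slope, sum_dotProduct, ← Finset.sum_add_distrib]
  refine Finset.sum_le_sum fun w _ => ?_
  rw [smul_dotProduct, smul_eq_mul, ← mul_add]
  exact mul_le_mul_of_nonneg_left (h.subgradient k t ht w R (hrec (t + 1) ht R hR w))
    (P.p_nonneg _ ht w)

lemma stageVal_mono_Vbar (hrec : P.RelativelyCompleteRecourse) (hbdd : P.BoundedFeasibleSets)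
    {j k t : ℕ} (hjk : j ≤ k) (ht : t ≤ P.T) {R : P.State t} (hR : R ∈ P.reach t) (w : P.Om t) :
    P.stageVal t (τ.Vbar j t) R w ≤ P.stageVal t (τ.Vbar k t) R w :=
  le_stageVal (hrec t ht R hR w) fun _ hx =>
    (stageVal_le hbdd ht (continuous_Vbar j ht) hR hx).trans
      (add_le_add_right (Vbar_mono hjk ht _) _)

/-- Each cut was computed from an earlier, hence smaller, approximation of the next stage. -/
lemma IsRun.Vbar_le (h : τ.IsRun Q ρ) (hrec : P.RelativelyCompleteRecourse)
    (hbdd : P.BoundedFeasibleSets) (k : ℕ) {t : ℕ} (ht : t < P.T) {R : P.State (t + 1)}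
    (hR : R ∈ P.reach (t + 1)) :
    τ.Vbar k t R ≤ ∑ w, P.p (t + 1) w * P.stageVal (t + 1) (τ.Vbar k (t + 1)) R w := by
  obtain ⟨j, hj, hj'⟩ := exists_Vbar_eq_cut (τ := τ) k ht R
  rw [hj']
  exact (h.cut_le hrec j ht hR).trans (Finset.sum_le_sum fun w _ =>
    mul_le_mul_of_nonneg_left (stageVal_mono_Vbar hrec hbdd hj ht hR w) (P.p_nonneg _ ht w))

/-- The approximations are lower bounds for the expected cost of every feasible policy. -/
lemma IsRun.Vbar_le_expCost (h : τ.IsRun Q ρ) (hrec : P.RelativelyCompleteRecourse)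
    (hbdd : P.BoundedFeasibleSets) (k : ℕ) {t : ℕ} (ht : t ≤ P.T) {R : P.State (t + 1)}
    (hR : R ∈ P.reach (t + 1)) {X : P.Policy} (hX : P.FeasibleFrom X (t + 1) R) :
    τ.Vbar k t R ≤ P.expCost X (t + 1) R := by
  rcases ht.lt_or_eq with ht' | rfl
  · rw [feasibleFrom_iff X ht'] at hX
    rw [expCost_eq X ht']
    refine (h.Vbar_le hrec hbdd k ht' hR).trans (Finset.sum_le_sum fun w _ =>
      mul_le_mul_of_nonneg_left ?_ (P.p_nonneg _ ht' w))
    refine (stageVal_le hbdd ht' (continuous_Vbar k ht') hR (hX w).1).trans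
      (add_le_add_right ?_ _)
    exact h.Vbar_le_expCost hrec hbdd k ht' (reach_succ hR (hX w).1) (hX w).2
  · rw [Vbar_T, expCost_T_succ]
termination_by P.T - t

end Trace

/-- A policy whose decisions are feasible and stay in an invariant family of sets is feasible. -/
lemma feasibleFrom_of_invariant {X : P.Policy} {I : ∀ t, Set (P.State t)}
    (h : ∀ t, t ≤ P.T → ∀ R ∈ I t, ∀ w,
      X t R w ∈ P.feas t R w ∧ P.B t w *ᵥ X t R w ∈ I (t + 1))
    {t : ℕ} (ht : t ≤ P.T + 1) {R : P.State t} (hR : R ∈ I t) : P.FeasibleFrom X t R := by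
  rcases ht.lt_or_eq with ht' | rfl
  · rw [feasibleFrom_iff X (Nat.lt_succ_iff.mp ht')]
    intro w
    obtain ⟨h1, h2⟩ := h t (by omega) R hR w
    exact ⟨h1, feasibleFrom_of_invariant h ht' h2⟩
  · intro ω
    simp [PathFeasible]
termination_by P.T + 1 - t

/-- Relatively complete recourse provides a policy that is feasible from every reachable state. -/
lemma exists_feasible_policy (hrec : P.RelativelyCompleteRecourse) :
    ∃ X : P.Policy, ∀ t, t ≤ P.T + 1 → ∀ R ∈ P.reach t, P.FeasibleFrom X t R := by
  classical
  refine ⟨fun t R w => if h : (P.feas t R w).Nonempty then h.some else 0, fun t ht R hR =>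
    feasibleFrom_of_invariant (I := P.reach) (fun t ht R hR w => ?_) ht hR⟩
  have h := hrec t ht R hR w
  rw [dif_pos h]
  exact ⟨h.some_mem, reach_succ hR h.some_mem⟩

/-! ### Recurrence of the sampled outcomes -/

section Sampling

variable {S : Type*} {τ : S → P.Trace}

lemma comap_sample_le_past_of_lt {j k s t : ℕ} (hj : j < k) (hs : s ≤ P.T) :
    MeasurableSpace.comap (fun z => (τ z).ω j s) inferInstance ≤ P.past τ k t := by
  refine le_trans ?_ (le_sup_left.trans le_sup_left)
  exact le_sup_left.trans (le_iSup₂_of_le j hj (le_iSup₂_of_le s hs le_rfl))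

lemma comap_decision_le_past_of_lt {j k s t : ℕ} (hj : j < k) (hs : s ≤ P.T) :
    MeasurableSpace.comap (fun z => (τ z).x j s) inferInstance ≤ P.past τ k t := by
  refine le_trans ?_ (le_sup_left.trans le_sup_left)
  exact le_sup_right.trans (le_iSup₂_of_le j hj (le_iSup₂_of_le s hs le_rfl))

lemma comap_sample_le_past_self {k s t : ℕ} (hs : s < t) :
    MeasurableSpace.comap (fun z => (τ z).ω k s) inferInstance ≤ P.past τ k t :=
  le_trans (le_iSup₂_of_le s hs le_sup_left) le_sup_right

lemma comap_decision_le_past_self {k s t : ℕ} (hs : s < t) :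
    MeasurableSpace.comap (fun z => (τ z).x k s) inferInstance ≤ P.past τ k t :=
  le_trans (le_iSup₂_of_le s hs le_sup_right) le_sup_right

lemma past_mono {t : ℕ} (ht : t ≤ P.T) : Monotone fun k => P.past τ k t := by
  intro j k hjk
  rcases hjk.eq_or_lt with rfl | hlt
  · exact le_rfl
  refine sup_le (sup_le ?_ ?_) ?_
  · refine le_trans ?_ (le_sup_left.trans le_sup_left)
    exact iSup₂_le fun i hi => le_iSup₂_of_le i (hi.trans hlt) le_rfl
  · refine le_trans ?_ (le_sup_right.trans le_sup_left)
    exact iSup₂_le fun i hi => le_iSup₂_of_le i (hi.trans hlt) le_rfl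
  · exact iSup₂_le fun s hs => sup_le (comap_sample_le_past_of_lt hlt (by omega))
      (comap_decision_le_past_of_lt hlt (by omega))

lemma measurable_entering_past (k t : ℕ) :
    Measurable[P.past τ k t] fun z => (τ z).entering k t := by
  cases t with
  | zero => exact @measurable_const _ _ _ (P.past τ k 0) _
  | succ t =>
    have hω : Measurable[P.past τ k (t + 1)] fun z => (τ z).ω k t :=
      Measurable.of_comap_le (comap_sample_le_past_self (Nat.lt_succ_self t))
    have hx : Measurable[P.past τ k (t + 1)] fun z => (τ z).x k t :=
      Measurable.of_comap_le (comap_decision_le_past_self (Nat.lt_succ_self t))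
    have hB : Measurable fun q : P.Om t × P.Dec t => P.B t q.1 *ᵥ q.2 :=
      measurable_from_prod_countable_right fun w =>
        (show Continuous fun y : P.Dec t => P.B t w *ᵥ y from
          continuous_const.matrix_mulVec continuous_id).measurable
    have hp : Measurable[P.past τ k (t + 1)] fun z => ((τ z).ω k t, (τ z).x k t) :=
      hω.prodMk hx
    exact hB.comp hp

variable [m0 : MeasurableSpace S] {μ : Measure S}

lemma SampledIndependently.past_le (hs : P.SampledIndependently μ τ) {k t : ℕ} (ht : t ≤ P.T) :
    P.past τ k t ≤ m0 := by
  refine sup_le (sup_le ?_ ?_) ?_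
  · exact iSup₂_le fun j _ => iSup₂_le fun s hs' =>
      sup_le (hs.measurable_sample j s hs').comap_le (hs.measurable_decision j s hs').comap_le
  · exact iSup₂_le fun j _ => iSup₂_le fun s hs' =>
      sup_le (hs.measurable_intercept j s hs').comap_le
        (iSup_le fun w => (hs.measurable_subgradient j s hs' w).comap_le)
  · exact iSup₂_le fun s hs' => sup_le (hs.measurable_sample k s (by omega)).comap_le
      (hs.measurable_decision k s (by omega)).comap_le

lemma tendsto_sum_atTop_of_frequently {f : ℕ → ℝ} (hf : ∀ k, 0 ≤ f k) {c : ℝ} (hc : 0 < c)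
    (h : ∃ᶠ k in atTop, c ≤ f k) :
    Tendsto (fun n => ∑ k ∈ Finset.range n, f k) atTop atTop := by
  rw [← not_summable_iff_tendsto_nat_atTop_of_nonneg hf]
  intro hsum
  exact h ((hsum.tendsto_atTop_zero.eventually_lt_const hc).mono fun k hk => not_le.mpr hk)

/-- By Lévy's extension of the Borel–Cantelli lemma, if stage `t` is entered through `U`
infinitely often, then every outcome of positive probability is sampled infinitely often at such
entries. -/
lemma SampledIndependently.ae_frequently_sample [IsProbabilityMeasure μ]
    (hs : P.SampledIndependently μ τ) {t : ℕ} (ht : t ≤ P.T) {w : P.Om t} (hw : 0 < P.p t w)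
    {U : Set (P.State t)} (hU : MeasurableSet U) :
    ∀ᵐ z ∂μ, (∃ᶠ k in atTop, (τ z).entering k t ∈ U) →
      ∃ᶠ k in atTop, (τ z).entering k t ∈ U ∧ (τ z).ω k t = w := by
  let ℱ : Filtration ℕ m0 := ⟨fun k => P.past τ k t, past_mono ht, fun _ => hs.past_le ht⟩
  let E : ℕ → Set S := fun k => {z | (τ z).entering k t ∈ U}
  let W : ℕ → Set S := fun k => {z | (τ z).ω k t = w}
  have hE : ∀ k, MeasurableSet[ℱ k] (E k) := fun k => measurable_entering_past k t hU
  have hWc : ∀ k, MeasurableSet[MeasurableSpace.comap (fun z => (τ z).ω k t) inferInstance] (W k) :=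
    fun k => ⟨{w}, measurableSet_singleton w, rfl⟩
  have hW0 : ∀ k, MeasurableSet (W k) := fun k => (hs.measurable_sample k t ht).comap_le _ (hWc k)
  -- the event of iteration `k` has index `k + 1`, so that the filtration at `k` precedes it
  let A : ℕ → Set S := fun n => Nat.casesOn n ∅ fun k => E k ∩ W k
  have hA : ∀ n, MeasurableSet[ℱ n] (A n) := by
    intro n
    cases n with
    | zero => exact @MeasurableSet.empty _ (ℱ 0)
    | succ k =>
      exact @MeasurableSet.inter _ (ℱ (k + 1)) _ _ (ℱ.mono (Nat.le_succ k) _ (hE k))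
        (comap_sample_le_past_of_lt (Nat.lt_succ_self k) ht _ (hWc k))
  have hcond : ∀ k, μ[(A (k + 1)).indicator (1 : S → ℝ) | ℱ k] =ᵐ[μ]
      (E k).indicator fun _ => P.p t w := by
    intro k
    have hind : (A (k + 1)).indicator (1 : S → ℝ) = (E k).indicator ((W k).indicator 1) := by
      rw [Set.indicator_indicator]
    have hint : Integrable ((W k).indicator (1 : S → ℝ)) μ :=
      (integrable_const (1 : ℝ)).indicator (hW0 k)
    have hindep : μ[(W k).indicator (1 : S → ℝ) | ℱ k] =ᵐ[μ]
        fun _ => ∫ z, (W k).indicator (1 : S → ℝ) z ∂μ :=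
      condExp_indep_eq (hs.measurable_sample k t ht).comap_le (hs.past_le ht)
        ((stronglyMeasurable_const (β := ℝ) (b := 1)).indicator (hWc k)) (hs.indep k t ht)
    have hval : ∫ z, (W k).indicator (1 : S → ℝ) z ∂μ = P.p t w := by
      rw [integral_indicator_one (hW0 k), Measure.real, hs.law k t ht w,
        ENNReal.toReal_ofReal hw.le]
    rw [hval] at hindep
    rw [hind]
    refine (condExp_indicator hint (hE k)).trans ?_
    filter_upwards [hindep] with z hz
    by_cases hzE : z ∈ E k
    · rw [Set.indicator_of_mem hzE, Set.indicator_of_mem hzE, hz]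
    · rw [Set.indicator_of_notMem hzE, Set.indicator_of_notMem hzE]
  filter_upwards [ae_mem_limsup_atTop_iff μ hA, ae_all_iff.mpr hcond] with z hz hz' hfreq
  have hlim : z ∈ limsup A atTop := by
    rw [hz]
    simp only [hz']
    refine tendsto_sum_atTop_of_frequently
      (fun k => Set.indicator_nonneg (fun _ _ => hw.le) _) hw (hfreq.mono fun k hk => ?_)
    rw [Set.indicator_of_mem (show z ∈ E k from hk)]
  rw [mem_limsup_iff_frequently_mem, frequently_atTop] at hlim
  rw [frequently_atTop]
  intro n
  obtain ⟨m, hm, hmem⟩ := hlim (n + 1)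
  cases m with
  | zero => omega
  | succ m => exact ⟨m, by omega, hmem⟩

/-- Almost surely, every cluster point of the states with which stage `t` is entered is a cluster
point along the iterations that sample any prescribed outcome. -/
lemma SampledIndependently.ae_forall_mapClusterPt [IsProbabilityMeasure μ]
    (hs : P.SampledIndependently μ τ) (hpos : ∀ ω : P.Scenario, 0 < P.scenarioProb ω) :
    ∀ᵐ z ∂μ, ∀ t, t ≤ P.T → ∀ (w : P.Om t) (R : P.State t),
      MapClusterPt R atTop (fun k => (τ z).entering k t) →
        MapClusterPt R (atTop ⊓ 𝓟 {k | (τ z).ω k t = w}) fun k => (τ z).entering k t := by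
  have h : ∀ t, t ≤ P.T → ∀ w : P.Om t, ∀ U ∈ TopologicalSpace.countableBasis (P.State t),
      ∀ᵐ z ∂μ, (∃ᶠ k in atTop, (τ z).entering k t ∈ U) →
        ∃ᶠ k in atTop, (τ z).entering k t ∈ U ∧ (τ z).ω k t = w := fun t ht w U hU =>
    hs.ae_frequently_sample ht (p_pos hpos ht w)
      (TopologicalSpace.isOpen_of_mem_countableBasis hU).measurableSet
  have h' : ∀ᵐ z ∂μ, ∀ t, t ≤ P.T → ∀ w : P.Om t,
      ∀ U ∈ TopologicalSpace.countableBasis (P.State t),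
      (∃ᶠ k in atTop, (τ z).entering k t ∈ U) →
        ∃ᶠ k in atTop, (τ z).entering k t ∈ U ∧ (τ z).ω k t = w := by
    refine ae_all_iff.mpr fun t => ae_all_iff.mpr fun ht => ae_all_iff.mpr fun w => ?_
    exact (ae_ball_iff (TopologicalSpace.countable_countableBasis _)).mpr (h t ht w)
  filter_upwards [h'] with z hz t ht w R hR
  rw [mapClusterPt_iff_frequently] at hR ⊢
  intro O hO
  obtain ⟨U, hU, hRU, hUO⟩ :=
    (TopologicalSpace.isBasis_countableBasis (P.State t)).mem_nhds_iff.mp hO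
  have hfr := hz t ht w U hU
    (hR U ((TopologicalSpace.isOpen_of_mem_countableBasis hU).mem_nhds hRU))
  rw [frequently_inf_principal]
  exact hfr.mono fun k hk => ⟨hk.2, hUO hk.1⟩

end Sampling

/-! ### The limit policy -/

namespace Trace

variable {τ : P.Trace} {Q : ∀ t, Matrix (Fin (P.m (t + 1))) (Fin (P.m (t + 1))) ℝ} {ρ : ℕ → ℝ}

/-- The cluster points of the states with which stage `t` is entered in the forward passes. -/
def limitStates (τ : P.Trace) (t : ℕ) : Set (P.State t) :=
  {R | MapClusterPt R atTop fun k => τ.entering k t}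

lemma IsRun.limitStates_subset_reach (h : τ.IsRun Q ρ) (hrec : P.RelativelyCompleteRecourse)
    (hbdd : P.BoundedFeasibleSets) {t : ℕ} (ht : t ≤ P.T + 1) : τ.limitStates t ⊆ P.reach t := by
  intro R hR
  obtain ⟨U, -, hU⟩ := mapClusterPt_iff_ultrafilter.mp hR
  exact (isCompact_reach hrec hbdd t ht).isClosed.mem_of_tendsto hU
    (Eventually.of_forall fun k => h.entering_mem_reach k t ht)

/-- With a nonnegative regularization term that is bounded on the reachable states, the forward
decisions are minimizers of the approximate objective up to a multiple of `ρ`. -/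
lemma IsRun.exists_forward_le (h : τ.IsRun Q ρ) (hrec : P.RelativelyCompleteRecourse)
    (hbdd : P.BoundedFeasibleSets) (hQ : ∀ t, t ≤ P.T → (Q t).PosSemidef) (hρ : ∀ k, 0 ≤ ρ k)
    {t : ℕ} (ht : t ≤ P.T) :
    ∃ C, ∀ k, P.stageObj t (τ.Vbar k t) (τ.ω (k + 1) t) (τ.x (k + 1) t) ≤
      P.stageVal t (τ.Vbar k t) (τ.entering (k + 1) t) (τ.ω (k + 1) t) + ρ (k + 1) / 2 * C := by
  have hc := isCompact_reach hrec hbdd (t + 1) (by omega)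
  have hcont : Continuous fun q : P.State (t + 1) × P.State (t + 1) =>
      (q.1 - q.2) ⬝ᵥ (Q t *ᵥ (q.1 - q.2)) :=
    (continuous_fst.sub continuous_snd).dotProduct
      (continuous_const.matrix_mulVec (continuous_fst.sub continuous_snd))
  obtain ⟨C, hC⟩ := (hc.prod hc).bddAbove_image hcont.continuousOn
  have hC' : ∀ R ∈ P.reach (t + 1), ∀ R' ∈ P.reach (t + 1),
      (R - R') ⬝ᵥ (Q t *ᵥ (R - R')) ≤ C := fun R hR R' hR' =>
    hC (Set.mem_image_of_mem _ (show (R, R') ∈ P.reach (t + 1) ×ˢ P.reach (t + 1) from ⟨hR, hR'⟩))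
  refine ⟨C, fun k => ?_⟩
  have hr := h.entering_mem_reach (k + 1) t (by omega)
  obtain ⟨y, hy⟩ := exists_isArgmin hrec hbdd ht (continuous_Vbar k ht) hr (τ.ω (k + 1) t)
  rw [hy.stageVal_eq]
  have hle := (h.forward (k + 1) t ht).2 y hy.1
  have hk2 : 0 ≤ ρ (k + 1) / 2 := div_nonneg (hρ _) two_pos.le
  have hq0 : ∀ d, 0 ≤ d ⬝ᵥ (Q t *ᵥ d) := fun d => by
    simpa using (hQ t ht).dotProduct_mulVec_nonneg d
  have hqC := hC' _ (reach_succ hr hy.1) _ (h.resource_mem_reach k ht)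
  have h1 := mul_nonneg hk2 (hq0 (P.B t (τ.ω (k + 1) t) *ᵥ τ.x (k + 1) t - τ.resource k t))
  have h2 := mul_le_mul_of_nonneg_left hqC hk2
  have h3 := mul_nonneg hk2 (hq0 (P.B t (τ.ω (k + 1) t) *ᵥ y - τ.resource k t))
  simp only [forwardObj] at hle
  split_ifs at hle <;> linarith

/-- Upper semicontinuity of the stage value at cluster points of the visited states.  It rests on
the subgradient inequality, the selected subgradients taking only finitely many values. -/
lemma IsRun.exists_error_stageVal_le (h : τ.IsRun Q ρ) (hd : τ.UsesDualBasic)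
    (hrec : P.RelativelyCompleteRecourse) (hbdd : P.BoundedFeasibleSets) {K : ℕ}
    (hK : ∀ k, K ≤ k → ∀ t, t ≤ P.T → τ.Vbar k t = τ.Vbar K t) {t : ℕ} (ht : t ≤ P.T)
    {U : Ultrafilter ℕ} (hU : (U : Filter ℕ) ≤ atTop) {R : P.State t} (hR : R ∈ P.reach t)
    (hlim : Tendsto (fun k => τ.entering k t) U (𝓝 R)) (w : P.Om t) :
    ∃ e : ℕ → ℝ, Tendsto e U (𝓝 0) ∧ ∀ᶠ k in U,
      P.stageVal t (τ.Vbar K t) (τ.entering k t) w ≤ P.stageVal t (τ.Vbar K t) R w + e k := by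
  cases t with
  | zero =>
    refine ⟨0, tendsto_const_nhds, Eventually.of_forall fun k => ?_⟩
    have : R = τ.entering k 0 := hR
    simp [this]
  | succ t =>
    obtain ⟨F, hF, hF'⟩ := h.exists_finite_dualData hd hrec hbdd ht
      (fun h' => h.finite_range_cutData hd hrec hbdd h') w
    have hβ : ∀ k, τ.β k t w ∈ (fun q : P.State (t + 1) × ℝ => -q.1) '' F := fun k => by
      obtain ⟨q, hq, hq', -⟩ := hF' k
      exact ⟨q, hq, hq'.symm⟩
    obtain ⟨b, -, hb⟩ := (hF.image _).isCompact.ultrafilter_le_nhds' (U.map fun k => τ.β k t w)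
      (Ultrafilter.mem_map.mpr (univ_mem' hβ))
    have hb' : Tendsto (fun k => τ.β k t w) U (𝓝 b) := hb
    refine ⟨fun k => -(τ.β k t w ⬝ᵥ (R - τ.entering k (t + 1))), ?_, ?_⟩
    · have hcont : Continuous fun q : P.State (t + 1) × P.State (t + 1) => -(q.1 ⬝ᵥ (R - q.2)) :=
        (continuous_fst.dotProduct (continuous_const.sub continuous_snd)).neg
      have := (hcont.tendsto (b, R)).comp (hb'.prodMk_nhds hlim)
      simpa [Function.comp_def] using this
    · filter_upwards [hU (eventually_ge_atTop K)] with k hk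
      have := h.subgradient k t ht w R (hrec (t + 1) ht R hR w)
      rw [hK k hk (t + 1) ht] at this
      have e : τ.entering k (t + 1) = τ.resource k t := rfl
      rw [e]
      linarith

/-- At a cluster point of the visited states, a cluster point of the forward decisions for a given
outcome minimizes the limit objective and leads again to a cluster point of the visited states. -/
lemma IsRun.exists_isArgmin_limitStates (h : τ.IsRun Q ρ) (hd : τ.UsesDualBasic)
    (hrec : P.RelativelyCompleteRecourse) (hbdd : P.BoundedFeasibleSets)
    (hQ : ∀ t, t ≤ P.T → (Q t).PosSemidef) (hρ : ∀ k, 0 ≤ ρ k) (hρlim : Tendsto ρ atTop (𝓝 0))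
    {K : ℕ} (hK : ∀ k, K ≤ k → ∀ t, t ≤ P.T → τ.Vbar k t = τ.Vbar K t) {t : ℕ} (ht : t ≤ P.T)
    {R : P.State t} (hR : R ∈ τ.limitStates t) {w : P.Om t}
    (hw : MapClusterPt R (atTop ⊓ 𝓟 {k | τ.ω k t = w}) fun k => τ.entering k t) :
    ∃ x, P.IsArgmin t R w (P.stageObj t (τ.Vbar K t) w) x ∧
      P.B t w *ᵥ x ∈ τ.limitStates (t + 1) := by
  have hRr := h.limitStates_subset_reach hrec hbdd (by omega) hR
  obtain ⟨U, hU, hlim⟩ := mapClusterPt_iff_ultrafilter.mp hw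
  have hUtop : (U : Filter ℕ) ≤ atTop := hU.trans inf_le_left
  have hUw : ∀ᶠ k in (U : Filter ℕ), τ.ω k t = w := hU (mem_inf_of_right (mem_principal_self _))
  have hreach : ∀ k, τ.entering k t ∈ P.reach t := fun k => h.entering_mem_reach k t (by omega)
  obtain ⟨x, hx, hxlim⟩ := exists_tendsto_feas hrec hbdd ht hlim hreach (x := fun k => τ.x k t)
    (hUw.mono fun k hk => by
      have := (h.forward k t ht).1
      rwa [hk] at this)
  obtain ⟨C, hC⟩ := h.exists_forward_le hrec hbdd hQ hρ ht
  obtain ⟨e, he, hle⟩ := h.exists_error_stageVal_le hd hrec hbdd hK ht hUtop hRr hlim w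
  have hVc := continuous_Vbar (τ := τ) K ht
  have hobj : Tendsto (fun k => P.stageObj t (τ.Vbar K t) w (τ.x k t)) U
      (𝓝 (P.stageObj t (τ.Vbar K t) w x)) :=
    ((continuous_stageObj hVc w).tendsto x).comp hxlim
  have hbound : Tendsto (fun k => P.stageVal t (τ.Vbar K t) R w + e k + ρ k / 2 * C) U
      (𝓝 (P.stageVal t (τ.Vbar K t) R w)) := by
    have hρU := ((hρlim.mono_left hUtop).div_const 2).mul_const C
    simpa using (he.const_add (P.stageVal t (τ.Vbar K t) R w)).add hρU
  have hmin : P.stageObj t (τ.Vbar K t) w x ≤ P.stageVal t (τ.Vbar K t) R w := by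
    refine le_of_tendsto_of_tendsto hobj hbound ?_
    filter_upwards [hUw, hle, hUtop (eventually_ge_atTop (K + 1))] with k hk hk' hkK
    obtain ⟨j, rfl⟩ : ∃ j, k = j + 1 := ⟨k - 1, by omega⟩
    have := hC j
    rw [hk, hK j (by omega) t ht] at this
    linarith
  refine ⟨x, ⟨hx, fun y hy => hmin.trans (stageVal_le hbdd ht hVc hRr hy)⟩, ?_⟩
  refine mapClusterPt_iff_ultrafilter.mpr ⟨U, hUtop, ?_⟩
  have hB : Continuous fun y : P.Dec t => P.B t w *ᵥ y :=
    continuous_const.matrix_mulVec continuous_id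
  refine ((hB.tendsto x).comp hxlim).congr' (hUw.mono fun k hk => ?_)
  simp only [Function.comp_apply, entering, resource, hk]

/-- The limit approximations satisfy the dynamic programming inequality at cluster points of the
visited states, because the cut added at a visited state is exact there. -/
lemma IsRun.sum_stageVal_le_Vbar (h : τ.IsRun Q ρ) (hrec : P.RelativelyCompleteRecourse)
    (hbdd : P.BoundedFeasibleSets) {K : ℕ}
    (hK : ∀ k, K ≤ k → ∀ t, t ≤ P.T → τ.Vbar k t = τ.Vbar K t) {t : ℕ} (ht : t < P.T)
    {R : P.State (t + 1)} (hR : R ∈ τ.limitStates (t + 1)) :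
    ∑ w, P.p (t + 1) w * P.stageVal (t + 1) (τ.Vbar K (t + 1)) R w ≤ τ.Vbar K t R := by
  have hRr := h.limitStates_subset_reach hrec hbdd (by omega) hR
  obtain ⟨U, hU, hlim⟩ := mapClusterPt_iff_ultrafilter.mp hR
  choose v hv hvlim using fun w => exists_tendsto_stageVal hrec hbdd ht
    (continuous_Vbar (τ := τ) K ht) w hlim (fun k => h.entering_mem_reach k (t + 1) (by omega)) hRr
  refine (Finset.sum_le_sum fun w _ =>
    mul_le_mul_of_nonneg_left (hv w) (P.p_nonneg _ ht w)).trans ?_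
  refine le_of_tendsto_of_tendsto
    (tendsto_finsetSum Finset.univ fun w _ => (hvlim w).const_mul (P.p (t + 1) w))
    (((continuous_Vbar (τ := τ) K ht.le).tendsto R).comp hlim) ?_
  filter_upwards [hU (eventually_ge_atTop K)] with k hk
  have h1 := cut_le_Vbar (τ := τ) (le_refl k) ht (τ.resource k t)
  rw [cut, sub_self, dotProduct_zero, add_zero, h.intercept k t ht, hK k hk _ ht.le,
    hK k hk _ ht] at h1
  exact h1

end Trace

lemma GivesOptimalPolicy.congr {V V' : ∀ t, P.State (t + 1) → ℝ} {X : P.Policy}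
    (h : P.GivesOptimalPolicy V X) (hV : ∀ t, t ≤ P.T → V' t = V t) :
    P.GivesOptimalPolicy V' X :=
  ⟨h.1, fun ω t ht => by rw [hV t ht]; exact h.2 ω t ht⟩

/-- A policy that is greedy for lower bounds `V` gives an optimal policy if the states it visits
stay in sets `I` on which `V` satisfies the dynamic programming inequality. -/
lemma givesOptimalPolicy_of_invariant (hrec : P.RelativelyCompleteRecourse)
    {V : ∀ t, P.State (t + 1) → ℝ} {X : P.Policy} {I : ∀ t, Set (P.State t)}
    (hV : ∀ t, t ≤ P.T → ∀ R ∈ P.reach (t + 1), ∀ Y : P.Policy, P.FeasibleFrom Y (t + 1) R →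
      V t R ≤ P.expCost Y (t + 1) R)
    (hVT : ∀ R, V P.T R = 0) (hI0 : 0 ∈ I 0) (hI : ∀ t, t ≤ P.T + 1 → I t ⊆ P.reach t)
    (hX : ∀ t, t ≤ P.T → ∀ R ∈ I t, ∀ w, P.IsArgmin t R w (P.stageObj t (V t) w) (X t R w) ∧
      P.B t w *ᵥ X t R w ∈ I (t + 1))
    (hdp : ∀ t, t < P.T → ∀ R ∈ I (t + 1),
      ∑ w, P.p (t + 1) w * P.stageVal (t + 1) (V (t + 1)) R w ≤ V t R) :
    P.GivesOptimalPolicy V X := by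
  have hfeas : ∀ t, t ≤ P.T + 1 → ∀ R ∈ I t, P.FeasibleFrom X t R := fun t ht R hR =>
    feasibleFrom_of_invariant (fun t ht R hR w => ⟨(hX t ht R hR w).1.1, (hX t ht R hR w).2⟩) ht hR
  have hcost : ∀ d t, t + d = P.T → ∀ R ∈ I (t + 1), P.expCost X (t + 1) R ≤ V t R := by
    intro d
    induction d with
    | zero =>
      rintro t rfl R -
      rw [hVT, expCost_T_succ]
    | succ d ih =>
      intro t ht R hR
      rw [expCost_eq X (by omega)]
      refine (Finset.sum_le_sum fun w _ => ?_).trans (hdp t (by omega) R hR)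
      refine mul_le_mul_of_nonneg_left ?_ (P.p_nonneg _ (by omega) w)
      obtain ⟨h1, h2⟩ := hX (t + 1) (by omega) R hR w
      rw [h1.stageVal_eq]
      exact add_le_add_right (ih (t + 1) (by omega) _ h2) _
  have hVstar_le : ∀ t, t ≤ P.T → ∀ R ∈ I (t + 1), P.Vstar t R ≤ V t R := by
    intro t ht R hR
    refine le_trans (csInf_le ⟨V t R, ?_⟩ ⟨X, hfeas (t + 1) (by omega) R hR, rfl⟩)
      (hcost (P.T - t) t (by omega) R hR)
    rintro _ ⟨Y, hY, rfl⟩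
    exact hV t ht R (hI _ (by omega) hR) Y hY
  have hle_Vstar : ∀ t, t ≤ P.T → ∀ R ∈ P.reach (t + 1), V t R ≤ P.Vstar t R := by
    intro t ht R hR
    obtain ⟨Z, hZ⟩ := exists_feasible_policy hrec
    refine le_csInf ⟨_, Z, hZ (t + 1) (by omega) R hR, rfl⟩ ?_
    rintro _ ⟨Y, hY, rfl⟩
    exact hV t ht R hR Y hY
  have hstate : ∀ ω : P.Realization, ∀ t, t ≤ P.T → P.stateAt X ω t ∈ I t := by
    intro ω t
    induction t with
    | zero => exact fun _ => hI0
    | succ t ih => exact fun ht => (hX t (by omega) _ (ih (by omega)) _).2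
  refine ⟨⟨hfeas 0 (by omega) 0 hI0, fun Y hY => ?_⟩, fun ω t ht => ?_⟩
  · rw [expCost_eq X (Nat.zero_le _), expCost_eq Y (Nat.zero_le _)]
    refine Finset.sum_le_sum fun w _ => mul_le_mul_of_nonneg_left ?_ (P.p_nonneg _ (Nat.zero_le _) w)
    rw [feasibleFrom_iff Y (Nat.zero_le _)] at hY
    obtain ⟨h1, h2⟩ := hX 0 (Nat.zero_le _) 0 hI0 w
    calc _ ≤ P.stageObj 0 (V 0) w (X 0 0 w) :=
          add_le_add_right (hcost P.T 0 (by omega) _ h2) _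
      _ ≤ P.stageObj 0 (V 0) w (Y 0 0 w) := h1.2 _ (hY w).1
      _ ≤ _ := add_le_add_right
          (hV 0 (Nat.zero_le _) _ (reach_succ (hI 0 (by omega) hI0) (hY w).1) Y (hY w).2) _
  · have hR := hstate ω t ht
    obtain ⟨h1, h2⟩ := hX t ht _ hR (ω t)
    have h3 : P.IsArgmin t (P.stateAt X ω t) (ω t) (P.stageObj t (P.Vstar t) (ω t))
        (X t (P.stateAt X ω t) (ω t)) := by
      refine ⟨h1.1, fun y hy => ?_⟩
      calc _ ≤ P.stageObj t (V t) (ω t) (X t (P.stateAt X ω t) (ω t)) :=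
            add_le_add_right (hVstar_le t ht _ h2) _
        _ ≤ P.stageObj t (V t) (ω t) y := h1.2 y hy
        _ ≤ _ := add_le_add_right
            (hle_Vstar t ht _ (reach_succ (hI t (by omega) hR) hy)) _
    refine ⟨h1, h3, ?_⟩
    rw [h1.stageVal_eq, h3.stageVal_eq]
    exact congrArg _ (le_antisymm (hle_Vstar t ht _ (hI _ (by omega) h2)) (hVstar_le t ht _ h2))

end MSLP

theorem mainTheorem1 (P : MSLP)
    (hrec : P.RelativelyCompleteRecourse)
    (hbdd : P.BoundedFeasibleSets)
    (hpos : ∀ ω : P.Scenario, 0 < P.scenarioProb ω)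
    (Q : ∀ t, Matrix (Fin (P.m (t + 1))) (Fin (P.m (t + 1))) ℝ)
    (hQ : ∀ t, t ≤ P.T → (Q t).PosSemidef)
    (ρ : ℕ → ℝ) (hρ : ∀ k, 0 ≤ ρ k) (hρlim : Filter.Tendsto ρ Filter.atTop (nhds 0))
    {S : Type*} [MeasurableSpace S] (μ : MeasureTheory.Measure S)
    [MeasureTheory.IsProbabilityMeasure μ]
    (τ : S → P.Trace)
    (hsample : P.SampledIndependently μ τ)
    (hrun : ∀ᵐ z ∂μ, (τ z).IsRun Q ρ)
    (hdual : ∀ᵐ z ∂μ, (τ z).UsesDualBasic) :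
    ∀ᵐ z ∂μ, ∃ K : ℕ, ∃ X : P.Policy, ∀ k, K ≤ k →
      (∀ t, t ≤ P.T → (τ z).Vbar k t = (τ z).Vbar K t) ∧
      P.GivesOptimalPolicy ((τ z).Vbar k) X := by
  filter_upwards [hrun, hdual, hsample.ae_forall_mapClusterPt hpos] with z h hd hrecur
  obtain ⟨K, hK⟩ := h.exists_forall_Vbar_eq hd hrec hbdd
  have hex : ∀ t R w, ∃ x : P.Dec t, t ≤ P.T → R ∈ (τ z).limitStates t →
      P.IsArgmin t R w (P.stageObj t ((τ z).Vbar K t) w) x ∧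
        P.B t w *ᵥ x ∈ (τ z).limitStates (t + 1) := by
    intro t R w
    by_cases hc : t ≤ P.T ∧ R ∈ (τ z).limitStates t
    · obtain ⟨x, hx⟩ := h.exists_isArgmin_limitStates hd hrec hbdd hQ hρ hρlim hK hc.1 hc.2
        (hrecur t hc.1 w R hc.2)
      exact ⟨x, fun _ _ => hx⟩
    · exact ⟨0, fun h1 h2 => absurd ⟨h1, h2⟩ hc⟩
  choose X hX using hex
  have hgives : P.GivesOptimalPolicy ((τ z).Vbar K) X :=
    MSLP.givesOptimalPolicy_of_invariant hrec (I := (τ z).limitStates)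
      (fun t ht R hR Y hY => h.Vbar_le_expCost hrec hbdd K ht hR hY)
      (fun R => MSLP.Trace.Vbar_T K R)
      (Filter.Tendsto.mapClusterPt tendsto_const_nhds)
      (fun t ht => h.limitStates_subset_reach hrec hbdd ht)
      (fun t ht R hR w => hX t R w ht hR)
      (fun t ht R hR => h.sum_stageVal_le_Vbar hrec hbdd hK ht hR)
  exact ⟨K, X, fun k hk => ⟨fun t ht => hK k hk t ht, hgives.congr fun t ht => hK k hk t ht⟩⟩
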